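/- Let $n\ge 1$ and let $\Delta=\{\alpha_1,\dots,\alpha_n\}\subset\mathbb{R}^n$ be a system of simple roots spanning the Euclidean space $\mathbb{R}^n$, with Cartan matrix $C_{ij}=2\langle\alpha_i,\alpha_j\rangle/\langle\alpha_j,\alpha_j\rangle$ of type $X_n\in\{A_n,B_n,C_n,D_n\}$. Let $r_i$ be the reflection in the hyperplane orthogonal to $\alpha_i$, let $W$ be the group generated by $r_1,\dots,r_n$, let $W\Delta$ be the set of roots, and let $\xi$ be the highest root. Put $\alpha_i^\vee=2\alpha_i/\langle\alpha_i,\alpha_i\rangle$, $Q^\vee=\mathbb{Z}\alpha_1^\vee+\dots+\mathbb{Z}\alpha_n^\vee$ and $P^\vee=\{a\in\mathbb{R}^n : \langle a,\alpha_i\rangle\in\mathbb{Z} \text{ for } i=1,\dots,n\}$. Let $$F=\{a\in\mathbb{R}^n : \langle a,\alpha_i\rangle\ge 0 \text{ for } i=1,\dots,n,\ \langle a,\xi\rangle\le 1\},$$ and, for a fixed $j\in\{1,\dots,n\}$, let $F^e=F\cup r_j(\operatorname{int}F)$. For a positive integer $M$ let $F^e_M=F^e_M(X_n)$ be the set of those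 cosets in $\frac1M P^\vee/Q^\vee$ which have a representative in $F^e$. Then, for every choice of $j$ and every positive integer $M$, with $\binom{a}{b}=0$ for $0\le a<b$: 1. For $A_n$, $n\ge 1$: $$|F^e_M(A_n)|=\binom{n+M}{n}+\binom{M-1}{n}.$$ 2. For $C_n$, $n\ge 2$: $$|F^e_{2k}(C_n)|=\binom{n+k}{n}+\binom{n+k-1}{n}+\binom{k}{n}+\binom{k-1}{n}\quad(k\ge 1),$$ $$|F^e_{2k+1}(C_n)|=2\binom{n+k}{n}+2\binom{k}{n}\quad(k\ge 0).$$ 3. For $B_n$, $n\ge 3$: $$|F^e_M(B_n)|=|F^e_M(C_n)|.$$ 4. For $D_n$, $n\ge 4$: $$|F^e_{2k}(D_n)|=\binom{n+k}{n}+6\binom{n+k-1}{n}+\binom{n+k-2}{n}+\binom{k+1}{n}+6\binom{k}{n}+\binom{k-1}{n}\quad(k\ge 1),$$ $$|F^e_{2k+1}(D_n)|=4\binom{n+k}{n}+4\binom{n+k-1}{n}+4\binom{k+1}{n}+4\binom{k}{n}\quad(k\ge 0).$$ -/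

import Mathlib

open scoped InnerProductSpace

noncomputable section

namespace EvenGrid

variable {n : ℕ}

/-- `α` is a system of simple roots spanning Euclidean space `ℝⁿ` whose Cartan matrix
`2⟨αᵢ, αⱼ⟩ / ⟨αⱼ, αⱼ⟩` is the given matrix `C`. -/
structure IsSimpleRootSystem (C : Matrix (Fin n) (Fin n) ℤ)
    (α : Fin n → EuclideanSpace ℝ (Fin n)) : Prop where
  linearIndependent : LinearIndependent ℝ α
  span_eq_top : Submodule.span ℝ (Set.range α) = ⊤
  cartan : ∀ i j, 2 * ⟪α i, α j⟫_ℝ / ⟪α j, α j⟫_ℝ = (C i j : ℝ)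

/-- The simple reflection `rᵢ`, i.e. the reflection in the hyperplane orthogonal to `αᵢ`. -/
def simpleReflection (α : Fin n → EuclideanSpace ℝ (Fin n)) (i : Fin n) :
    EuclideanSpace ℝ (Fin n) ≃ₗᵢ[ℝ] EuclideanSpace ℝ (Fin n) :=
  (Submodule.span ℝ {α i})ᗮ.reflection

/-- The formula `rᵢ a = a - (2⟨a, αᵢ⟩ / ⟨αᵢ, αᵢ⟩) αᵢ`. -/
theorem simpleReflection_apply (α : Fin n → EuclideanSpace ℝ (Fin n)) (i : Fin n)
    (a : EuclideanSpace ℝ (Fin n)) :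
    simpleReflection α i a = a - (2 * ⟪a, α i⟫_ℝ / ⟪α i, α i⟫_ℝ) • α i := by
  rw [simpleReflection, Submodule.reflection_orthogonal_apply,
    Submodule.reflection_singleton_apply, real_inner_self_eq_norm_sq, real_inner_comm,
    mul_div_assoc, ← smul_smul, ofNat_smul_eq_nsmul ℝ 2]
  simp

/-- The Weyl group `W`, generated by the simple reflections. -/
def weylGroup (α : Fin n → EuclideanSpace ℝ (Fin n)) :
    Subgroup (EuclideanSpace ℝ (Fin n) ≃ₗᵢ[ℝ] EuclideanSpace ℝ (Fin n)) :=
  Subgroup.closure (Set.range (simpleReflection α))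

/-- The roots: the images of the simple roots under the Weyl group. -/
def roots (α : Fin n → EuclideanSpace ℝ (Fin n)) : Set (EuclideanSpace ℝ (Fin n)) :=
  {β | ∃ w ∈ weylGroup α, ∃ i, β = w (α i)}

/-- `ξ` is the highest root: a root such that `ξ - β` is a combination of simple roots with
nonnegative integer coefficients for every root `β`. -/
def IsHighestRoot (α : Fin n → EuclideanSpace ℝ (Fin n)) (ξ : EuclideanSpace ℝ (Fin n)) : Prop :=
  ξ ∈ roots α ∧ ∀ β ∈ roots α, ∃ c : Fin n → ℕ, ξ - β = ∑ i, c i • α i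

/-- The highest root `ξ`. -/
def highestRoot (α : Fin n → EuclideanSpace ℝ (Fin n)) : EuclideanSpace ℝ (Fin n) :=
  Classical.epsilon (IsHighestRoot α)

/-- There is at most one highest root. -/
theorem IsHighestRoot.unique {α : Fin n → EuclideanSpace ℝ (Fin n)} (hα : LinearIndependent ℝ α)
    {ξ ξ' : EuclideanSpace ℝ (Fin n)} (h : IsHighestRoot α ξ) (h' : IsHighestRoot α ξ') :
    ξ = ξ' := by
  obtain ⟨c, hc⟩ := h.2 ξ' h'.1
  obtain ⟨d, hd⟩ := h'.2 ξ h.1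
  have key : ∑ i, ((c i : ℝ) + (d i : ℝ)) • α i = 0 := by
    simp only [add_smul, Finset.sum_add_distrib, Nat.cast_smul_eq_nsmul]
    rw [← hc, ← hd]
    abel
  have hz := Fintype.linearIndependent_iff.1 hα _ key
  have hc0 : ∀ i, c i = 0 := by
    intro i
    have := hz i
    norm_cast at this
    omega
  rw [← sub_eq_zero, hc]
  simp [hc0]

/-- The dual root `αᵢ^∨ = 2αᵢ / ⟨αᵢ, αᵢ⟩`. -/
def dualRoot (α : Fin n → EuclideanSpace ℝ (Fin n)) (i : Fin n) : EuclideanSpace ℝ (Fin n) :=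
  (2 / ⟪α i, α i⟫_ℝ) • α i

/-- The dual root lattice `Q^∨ = ℤα₁^∨ + ⋯ + ℤαₙ^∨`. -/
def dualRootLattice (α : Fin n → EuclideanSpace ℝ (Fin n)) :
    AddSubgroup (EuclideanSpace ℝ (Fin n)) :=
  AddSubgroup.closure (Set.range (dualRoot α))

/-- The dual weight lattice `P^∨`: the vectors with integer inner products with all the
simple roots. -/
def dualWeightLattice (α : Fin n → EuclideanSpace ℝ (Fin n)) :
    AddSubgroup (EuclideanSpace ℝ (Fin n)) where
  carrier := {a | ∀ i, ∃ z : ℤ, ⟪a, α i⟫_ℝ = z}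
  zero_mem' := fun _ => ⟨0, by simp⟩
  add_mem' := by
    intro a b ha hb i
    obtain ⟨y, hy⟩ := ha i
    obtain ⟨z, hz⟩ := hb i
    exact ⟨y + z, by rw [inner_add_left, hy, hz]; push_cast; rfl⟩
  neg_mem' := by
    intro a ha i
    obtain ⟨y, hy⟩ := ha i
    exact ⟨-y, by rw [inner_neg_left, hy]; push_cast; rfl⟩

/-- The fundamental region `F` of the affine Weyl group. -/
def fundRegion (α : Fin n → EuclideanSpace ℝ (Fin n)) : Set (EuclideanSpace ℝ (Fin n)) :=
  {a | (∀ i, 0 ≤ ⟪a, α i⟫_ℝ) ∧ ⟪a, highestRoot α⟫_ℝ ≤ 1}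

/-- The region `F^e = F ∪ rⱼ int(F)`, a fundamental region of the even affine Weyl group. -/
def evenRegion (α : Fin n → EuclideanSpace ℝ (Fin n)) (j : Fin n) :
    Set (EuclideanSpace ℝ (Fin n)) :=
  fundRegion α ∪ simpleReflection α j '' interior (fundRegion α)

/-- The grid `F^e_M`: the cosets in `(1/M)P^∨ / Q^∨` with a representative in `F^e`. -/
def evenGrid (α : Fin n → EuclideanSpace ℝ (Fin n)) (j : Fin n) (M : ℕ) :
    Set (EuclideanSpace ℝ (Fin n) ⧸ dualRootLattice α) :=
  (QuotientAddGroup.mk '' {a | (M : ℝ) • a ∈ dualWeightLattice α}) ∩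
    (QuotientAddGroup.mk '' evenRegion α j)

end EvenGrid

end

namespace EvenGrid

variable {n : ℕ} {α : Fin n → EuclideanSpace ℝ (Fin n)}

/-! The grid is counted by unique representatives in `F^e`. The key is `sum_dualRoot_eq_zero`: a
vector of `Q^∨` that pairs with every root into `[-1, 1]` is zero. The difference of two points of
`F` satisfies this bound, because each pairs with a positive root into `[0, 1]`; so points of `F`
are pairwise incongruent modulo `Q^∨`. A variant of the estimate separates `F` from `r_j(int F)`,
and stability of `Q^∨` under `r_j` gives injectivity on the reflected piece. No structure theory of
the affine Weyl group is needed.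

If `ξ = ∑ m_i α_i`, the numbers `s_i = M⟨a, α_i⟩` turn the points of `(1/M)P^∨` in `F` into natural
solutions of `∑ m_i s_i ≤ M`, and those in `int F` into positive solutions of `∑ m_i s_i < M`.
`IsDominatingRoot.ncard_evenGrid` adds the two counts, so the answer depends only on the `m_i` and
not on `j`.

Type A has all `m_i = 1`; types B and C have one coefficient `1` and the rest `2`, hence equal
counts; type D has three coefficients `1` and the rest `2`. Splitting each variable of coefficient
`1` by parity (`ncard_setOf_sum_add_le_split`) makes all coefficients `2`, which leaves binomials of
floors.

The highest root is found in coordinates `e k` with `α_k = e k - e (k + 1)`, where simple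
reflections act by permutations and signs. -/

/-! ### Simple reflections and roots. -/

theorem simpleReflection_eq (i : Fin n) (a : EuclideanSpace ℝ (Fin n)) :
    simpleReflection α i a = a - ⟪a, α i⟫_ℝ • dualRoot α i := by
  rw [simpleReflection_apply, dualRoot, smul_smul]
  congr 2
  ring

theorem simpleReflection_simpleReflection (i : Fin n) (a : EuclideanSpace ℝ (Fin n)) :
    simpleReflection α i (simpleReflection α i a) = a :=
  Submodule.reflection_reflection _ _

theorem inner_simpleReflection_left (i : Fin n) (a b : EuclideanSpace ℝ (Fin n)) :
    ⟪simpleReflection α i a, b⟫_ℝ = ⟪a, simpleReflection α i b⟫_ℝ := by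
  rw [← (simpleReflection α i).inner_map_map, simpleReflection_simpleReflection]

theorem simpleReflection_self (i : Fin n) : simpleReflection α i (α i) = -α i :=
  Submodule.reflection_mem_subspace_orthogonalComplement_eq_neg
    (Submodule.le_orthogonal_orthogonal _ (Submodule.mem_span_singleton_self _))

theorem simpleReflection_mem_roots (i : Fin n) {β : EuclideanSpace ℝ (Fin n)}
    (hβ : β ∈ roots α) : simpleReflection α i β ∈ roots α := by
  obtain ⟨w, hw, k, rfl⟩ := hβ
  exact ⟨simpleReflection α i * w,
    mul_mem (Subgroup.subset_closure ⟨i, rfl⟩) hw, k, rfl⟩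

theorem simple_mem_roots (i : Fin n) : α i ∈ roots α :=
  ⟨1, one_mem _, i, rfl⟩

theorem neg_mem_roots {β : EuclideanSpace ℝ (Fin n)} (hβ : β ∈ roots α) : -β ∈ roots α := by
  obtain ⟨w, hw, k, rfl⟩ := hβ
  refine ⟨w * simpleReflection α k, mul_mem hw (Subgroup.subset_closure ⟨k, rfl⟩), k, ?_⟩
  change _ = w (simpleReflection α k (α k))
  rw [simpleReflection_self, map_neg]

/-- A set of vectors that contains the simple roots and is stable under the simple reflections
contains all roots. -/
theorem roots_subset {R : Set (EuclideanSpace ℝ (Fin n))} (h : ∀ i, α i ∈ R)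
    (hR : ∀ i, ∀ β ∈ R, simpleReflection α i β ∈ R) : roots α ⊆ R := by
  rintro _ ⟨w, hw, k, rfl⟩
  have key : ∀ β ∈ R, w β ∈ R := by
    refine Subgroup.closure_induction'' (p := fun w _ => ∀ β ∈ R, w β ∈ R) ?_ ?_ ?_ ?_ hw
    · rintro _ ⟨i, rfl⟩
      exact hR i
    · rintro _ ⟨i, rfl⟩ β hβ
      have : (simpleReflection α i)⁻¹ β = simpleReflection α i β :=
        (simpleReflection α i).symm_apply_eq.2 (simpleReflection_simpleReflection i β).symm
      rw [this]
      exact hR i β hβ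
    · intro β hβ
      exact hβ
    · intro x y _ _ hx hy β hβ
      exact hx _ (hy _ hβ)
  exact key _ (h k)

theorem IsSimpleRootSystem.inner_dualRoot {C : Matrix (Fin n) (Fin n) ℤ}
    (hα : IsSimpleRootSystem C α) (i j : Fin n) : ⟪α i, dualRoot α j⟫_ℝ = C i j := by
  rw [← hα.cartan i j, dualRoot, inner_smul_right]
  ring

/-! ### Short vectors of the dual root lattice. -/

/-- A vector of the dual root lattice whose inner products with all roots have absolute value
at most `1` vanishes. -/
theorem sum_dualRoot_eq_zero {C : Matrix (Fin n) (Fin n) ℤ} (hα : IsSimpleRootSystem C α) (N : ℕ) :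
    ∀ c : Fin n → ℤ, ∑ i, (c i).natAbs ≤ N →
      (∀ β ∈ roots α, |⟪∑ i, c i • dualRoot α i, β⟫_ℝ| ≤ 1) →
        ∑ i, c i • dualRoot α i = 0 := by
  induction N with
  | zero =>
    intro c hc _
    have : ∀ i, c i = 0 := by simpa using hc
    simp [this]
  | succ N ih =>
    intro c hc h
    by_contra hq
    set q := ∑ i, c i • dualRoot α i with hqdef
    -- Expanding one factor of `⟪q, q⟫ > 0` gives a positive sum, so some `c i` has the same sign as
    -- the integer `z = ⟪q, α i⟫`, which the hypothesis forces to be `±1`.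
    have hpos : 0 < ∑ i, (c i : ℝ) * (2 / ⟪α i, α i⟫_ℝ * ⟪q, α i⟫_ℝ) := by
      have h1 : 0 < ⟪q, q⟫_ℝ := real_inner_self_pos.2 hq
      have h2 (v : EuclideanSpace ℝ (Fin n)) :
          ⟪q, v⟫_ℝ = ∑ i, (c i : ℝ) * (2 / ⟪α i, α i⟫_ℝ * ⟪v, α i⟫_ℝ) := by
        rw [hqdef, sum_inner]
        refine Finset.sum_congr rfl fun i _ => ?_
        rw [← Int.cast_smul_eq_zsmul ℝ, real_inner_smul_left, dualRoot, real_inner_smul_left,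
          real_inner_comm v]
      rwa [h2] at h1
    obtain ⟨i, -, hi⟩ := Finset.exists_lt_of_sum_lt (s := Finset.univ)
      (f := fun _ : Fin n => (0 : ℝ))
      (g := fun i => (c i : ℝ) * (2 / ⟪α i, α i⟫_ℝ * ⟪q, α i⟫_ℝ)) (by rw [Finset.sum_const_zero]; exact hpos)
    obtain ⟨z, hz⟩ : ∃ z : ℤ, ⟪q, α i⟫_ℝ = z := by
      refine ⟨∑ k, c k * C i k, ?_⟩
      rw [hqdef, sum_inner]
      push_cast
      refine Finset.sum_congr rfl fun k _ => ?_
      rw [← Int.cast_smul_eq_zsmul ℝ, inner_smul_left, real_inner_comm, hα.inner_dualRoot]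
      rfl
    have hz1 : |z| ≤ 1 := by
      have := h _ (simple_mem_roots i)
      rw [hz] at this
      exact_mod_cast this
    have hcz : 0 < c i * z := by
      have h3 : 0 < 2 / ⟪α i, α i⟫_ℝ := by
        have : 0 < ⟪α i, α i⟫_ℝ := real_inner_self_pos.2 (hα.linearIndependent.ne_zero i)
        positivity
      rw [hz] at hi
      have h4 : 0 < 2 / ⟪α i, α i⟫_ℝ * ((c i : ℝ) * z) := by
        rwa [mul_left_comm] at hi
      exact_mod_cast (pos_iff_pos_of_mul_pos h4).1 h3
    -- Reflecting replaces `c i` by `c i - z`, which is closer to zero by one. The bound on pairings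
    -- survives because the roots are stable, so the induction applies to the reflected vector.
    have hr : simpleReflection α i q
        = ∑ k, (Function.update c i (c i - z)) k • dualRoot α k := by
      rw [simpleReflection_eq, hz, hqdef, ← Finset.add_sum_erase _ _ (Finset.mem_univ i),
        ← Finset.add_sum_erase _ (fun k => Function.update c i (c i - z) k • dualRoot α k)
          (Finset.mem_univ i), Function.update_self, sub_smul, Int.cast_smul_eq_zsmul]
      have : ∑ k ∈ Finset.univ.erase i, Function.update c i (c i - z) k • dualRoot α k
          = ∑ k ∈ Finset.univ.erase i, c k • dualRoot α k :=
        Finset.sum_congr rfl fun k hk => by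
          rw [Function.update_of_ne (Finset.ne_of_mem_erase hk)]
      rw [this]
      abel
    have h0 := ih (Function.update c i (c i - z)) ?_ ?_
    · rw [← hr] at h0
      exact hq ((simpleReflection α i).map_eq_zero_iff.1 h0)
    · rw [← Finset.add_sum_erase _ _ (Finset.mem_univ i)] at hc ⊢
      have : ∑ k ∈ Finset.univ.erase i, (Function.update c i (c i - z) k).natAbs
          = ∑ k ∈ Finset.univ.erase i, (c k).natAbs :=
        Finset.sum_congr rfl fun k hk => by
          rw [Function.update_of_ne (Finset.ne_of_mem_erase hk)]
      rw [this, Function.update_self]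
      have hz' : z = 1 ∨ z = -1 ∨ z = 0 := by grind
      rcases hz' with rfl | rfl | rfl <;> omega
    · intro β hβ
      rw [← hr, inner_simpleReflection_left]
      exact h _ (simpleReflection_mem_roots i hβ)

theorem eq_zero_of_mem_dualRootLattice {C : Matrix (Fin n) (Fin n) ℤ}
    (hα : IsSimpleRootSystem C α) {q : EuclideanSpace ℝ (Fin n)} (hq : q ∈ dualRootLattice α)
    (h : ∀ β ∈ roots α, |⟪q, β⟫_ℝ| ≤ 1) : q = 0 := by
  obtain ⟨c, rfl⟩ := AddSubgroup.exists_of_mem_closure_range _ _ hq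
  exact sum_dualRoot_eq_zero hα _ c le_rfl h

theorem dualRootLattice_le {C : Matrix (Fin n) (Fin n) ℤ} (hα : IsSimpleRootSystem C α) :
    dualRootLattice α ≤ dualWeightLattice α := by
  rw [dualRootLattice, AddSubgroup.closure_le]
  rintro _ ⟨j, rfl⟩ i
  exact ⟨C i j, by rw [real_inner_comm, hα.inner_dualRoot]⟩

/-! ### Positive roots and the dominating root. -/

/-- The vectors that are combinations of simple roots with nonnegative integer coefficients. -/
def positiveCone (α : Fin n → EuclideanSpace ℝ (Fin n)) :
    AddSubmonoid (EuclideanSpace ℝ (Fin n)) :=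
  AddSubmonoid.closure (Set.range α)

theorem simple_mem_positiveCone (i : Fin n) : α i ∈ positiveCone α :=
  AddSubmonoid.subset_closure ⟨i, rfl⟩

theorem mem_positiveCone {v : EuclideanSpace ℝ (Fin n)} :
    v ∈ positiveCone α ↔ ∃ c : Fin n → ℕ, v = ∑ i, c i • α i :=
  AddSubmonoid.mem_closure_range_iff_of_fintype

/-- Every root is positive or negative, and `ξ` is a root that exceeds every root. -/
structure IsDominatingRoot (α : Fin n → EuclideanSpace ℝ (Fin n))
    (ξ : EuclideanSpace ℝ (Fin n)) : Prop where
  mem_roots : ξ ∈ roots α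
  pos_or_neg : ∀ β ∈ roots α, β ∈ positiveCone α ∨ -β ∈ positiveCone α
  sub_mem_positiveCone : ∀ β ∈ roots α, ξ - β ∈ positiveCone α

/-- Since `highestRoot` is a choice, it becomes computable only through uniqueness: any explicit
root that dominates all others must be the chosen one. -/
theorem IsDominatingRoot.highestRoot_eq {ξ : EuclideanSpace ℝ (Fin n)}
    (h : IsDominatingRoot α ξ) (hα : LinearIndependent ℝ α) : highestRoot α = ξ := by
  have hξ : IsHighestRoot α ξ := ⟨h.mem_roots, fun β hβ => mem_positiveCone.1 (h.sub_mem_positiveCone β hβ)⟩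
  exact IsHighestRoot.unique hα (Classical.epsilon_spec (p := IsHighestRoot α) ⟨ξ, hξ⟩) hξ

theorem inner_nonneg_of_mem_positiveCone {a v : EuclideanSpace ℝ (Fin n)}
    (ha : ∀ i, 0 ≤ ⟪a, α i⟫_ℝ) (hv : v ∈ positiveCone α) : 0 ≤ ⟪a, v⟫_ℝ := by
  obtain ⟨c, rfl⟩ := mem_positiveCone.1 hv
  rw [inner_sum]
  refine Finset.sum_nonneg fun i _ => ?_
  rw [← Nat.cast_smul_eq_nsmul ℝ, inner_smul_right]
  exact mul_nonneg (Nat.cast_nonneg _) (ha i)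

/-! ### Incongruence in `F^e` and reduction to counting integer points. -/

section Region

variable {C : Matrix (Fin n) (Fin n) ℤ} {ξ : EuclideanSpace ℝ (Fin n)}

theorem IsDominatingRoot.inner_le (hξ : IsDominatingRoot α ξ) {a β : EuclideanSpace ℝ (Fin n)}
    (ha : ∀ i, 0 ≤ ⟪a, α i⟫_ℝ) (hβ : β ∈ roots α) : ⟪a, β⟫_ℝ ≤ ⟪a, ξ⟫_ℝ := by
  have := inner_nonneg_of_mem_positiveCone ha (hξ.sub_mem_positiveCone β hβ)
  rw [inner_sub_right] at this
  linarith

/-- To bound the inner products with all roots it suffices to consider positive roots. -/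
theorem IsDominatingRoot.abs_inner_le (hξ : IsDominatingRoot α ξ) {q : EuclideanSpace ℝ (Fin n)}
    (h : ∀ β ∈ roots α, β ∈ positiveCone α → |⟪q, β⟫_ℝ| ≤ 1) : ∀ β ∈ roots α, |⟪q, β⟫_ℝ| ≤ 1 := by
  intro β hβ
  rcases hξ.pos_or_neg β hβ with h' | h'
  · exact h β hβ h'
  · rw [← abs_neg, ← inner_neg_right]
    exact h _ (neg_mem_roots hβ) h'

/-- Points of the fundamental region are inequivalent modulo the dual root lattice. -/
theorem IsDominatingRoot.eq_of_sub_mem (hα : IsSimpleRootSystem C α) (hξ : IsDominatingRoot α ξ)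
    {a b : EuclideanSpace ℝ (Fin n)} (ha : ∀ i, 0 ≤ ⟪a, α i⟫_ℝ) (ha1 : ⟪a, ξ⟫_ℝ ≤ 1)
    (hb : ∀ i, 0 ≤ ⟪b, α i⟫_ℝ) (hb1 : ⟪b, ξ⟫_ℝ ≤ 1) (hab : a - b ∈ dualRootLattice α) :
    a = b := by
  refine sub_eq_zero.1 (eq_zero_of_mem_dualRootLattice hα hab (hξ.abs_inner_le ?_))
  intro β hβ hpos
  have h1 := hξ.inner_le ha hβ
  have h2 := hξ.inner_le hb hβ
  have h3 := inner_nonneg_of_mem_positiveCone ha hpos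
  have h4 := inner_nonneg_of_mem_positiveCone hb hpos
  rw [inner_sub_left, abs_le]
  constructor <;> linarith

/-- A positive root whose reflection in `αⱼ` is negative is a multiple of `αⱼ`. -/
theorem exists_eq_smul_of_neg_simpleReflection_mem (hα : IsSimpleRootSystem C α) (j : Fin n)
    {β : EuclideanSpace ℝ (Fin n)} (hβ : β ∈ positiveCone α)
    (hβ' : -simpleReflection α j β ∈ positiveCone α) : ∃ c : ℕ, β = c • α j := by
  obtain ⟨c, hc⟩ := mem_positiveCone.1 hβ
  obtain ⟨d, hd⟩ := mem_positiveCone.1 hβ'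
  rw [simpleReflection_eq, dualRoot, smul_smul] at hd
  set t := ⟪β, α j⟫_ℝ * (2 / ⟪α j, α j⟫_ℝ)
  -- `β` and `-r_j β` add up to `t • α j`, so away from `j` their nonnegative coefficients cancel
  -- and must vanish.
  have key : ∑ i, ((c i : ℝ) + d i - if i = j then t else 0) • α i = 0 := by
    simp only [sub_smul, add_smul, Finset.sum_sub_distrib, Finset.sum_add_distrib,
      Nat.cast_smul_eq_nsmul, ite_smul, zero_smul, Finset.sum_ite_eq', Finset.mem_univ, if_true]
    rw [← hc, ← hd]
    abel
  have hz := Fintype.linearIndependent_iff.1 hα.linearIndependent _ key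
  refine ⟨c j, ?_⟩
  rw [hc, Finset.sum_eq_single j]
  · intro i _ hij
    have := hz i
    rw [if_neg hij, sub_zero] at this
    norm_cast at this
    have : c i = 0 := by omega
    rw [this, zero_smul]
  · simp

/-- A point of the fundamental region is inequivalent modulo the dual root lattice to a simple
reflection of an interior point. -/
theorem IsDominatingRoot.sub_simpleReflection_notMem (hα : IsSimpleRootSystem C α)
    (hξ : IsDominatingRoot α ξ) (j : Fin n)
    {a b : EuclideanSpace ℝ (Fin n)} (ha : ∀ i, 0 ≤ ⟪a, α i⟫_ℝ) (ha1 : ⟪a, ξ⟫_ℝ ≤ 1)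
    (hb : ∀ i, 0 < ⟪b, α i⟫_ℝ) (hb1 : ⟪b, ξ⟫_ℝ < 1) :
    a - simpleReflection α j b ∉ dualRootLattice α := by
  intro hab
  have hb' : ∀ i, 0 ≤ ⟪b, α i⟫_ℝ := fun i => (hb i).le
  obtain ⟨z, hz⟩ := dualRootLattice_le hα hab j
  have hq : a - simpleReflection α j b = 0 := by
    refine eq_zero_of_mem_dualRootLattice hα hab (hξ.abs_inner_le ?_)
    intro β hβ hpos
    have h1 := hξ.inner_le ha hβ
    have h3 := inner_nonneg_of_mem_positiveCone ha hpos
    have hrβ := simpleReflection_mem_roots j hβ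
    have e : ⟪a - simpleReflection α j b, β⟫_ℝ
        = ⟪a, β⟫_ℝ - ⟪b, simpleReflection α j β⟫_ℝ := by
      rw [inner_sub_left, inner_simpleReflection_left]
    rcases hξ.pos_or_neg _ hrβ with h | h
    · have h2 := hξ.inner_le hb' hrβ
      have h4 := inner_nonneg_of_mem_positiveCone hb' h
      rw [e, abs_le]
      constructor <;> linarith
    -- Here `⟪a, β⟫` and `⟪b, -r_j β⟫` add up, so the naive bound is only `[0, 2)`, strict since `b`
    -- is interior. But `β` is a multiple of `α j`, hence the pairing is an integer and so at most
    -- `1`.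
    · obtain ⟨c, hc⟩ := exists_eq_smul_of_neg_simpleReflection_mem hα j hpos h
      have h2 := hξ.inner_le hb' (neg_mem_roots hrβ)
      have h4 := inner_nonneg_of_mem_positiveCone hb' h
      rw [inner_neg_right] at h2 h4
      have e2 : ⟪a - simpleReflection α j b, β⟫_ℝ = ((c * z : ℤ) : ℝ) := by
        rw [hc, ← Nat.cast_smul_eq_nsmul ℝ, real_inner_smul_right, hz]
        push_cast
        rfl
      have h5 : ((c * z : ℤ) : ℝ) < 2 := by linarith
      have h6 : (0 : ℝ) ≤ ((c * z : ℤ) : ℝ) := by linarith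
      rw [e2, ← Int.cast_abs]
      have h5' : (c * z : ℤ) < 2 := by exact_mod_cast h5
      have h6' : (0 : ℤ) ≤ c * z := by exact_mod_cast h6
      have : |(c * z : ℤ)| ≤ 1 := by
        rw [abs_of_nonneg h6']
        omega
      exact_mod_cast this
  -- Now `a = r_j b`, which would make `⟪a, α j⟫ = -⟪b, α j⟫` negative.
  have h := ha j
  rw [sub_eq_zero.1 hq, inner_simpleReflection_left, simpleReflection_self, inner_neg_right] at h
  linarith [hb j]

/-- A nonzero functional is a continuous linear surjection, hence open, so taking preimages commutes
with taking interiors. -/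
theorem interior_setOf_inner_ge {v : EuclideanSpace ℝ (Fin n)} (hv : v ≠ 0) (c : ℝ) :
    interior {a | c ≤ ⟪a, v⟫_ℝ} = {a | c < ⟪a, v⟫_ℝ} := by
  have hs : Function.Surjective (innerSL ℝ v) := by
    intro t
    refine ⟨(t / ⟪v, v⟫_ℝ) • v, ?_⟩
    rw [innerSL_apply_apply, real_inner_smul_right, div_mul_cancel₀]
    exact (real_inner_self_pos.2 hv).ne'
  have := (innerSL ℝ v).interior_preimage hs (Set.Ici c)
  rw [interior_Ici] at this
  simp only [real_inner_comm v]
  exact this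

theorem interior_fundRegion (hα : LinearIndependent ℝ α) (hξ : IsDominatingRoot α ξ)
    (hξ0 : ξ ≠ 0) :
    interior (fundRegion α) = {a | (∀ i, 0 < ⟪a, α i⟫_ℝ) ∧ ⟪a, ξ⟫_ℝ < 1} := by
  have h : fundRegion α = (⋂ i, {a | 0 ≤ ⟪a, α i⟫_ℝ}) ∩ {a | -1 ≤ ⟪a, -ξ⟫_ℝ} := by
    ext a
    simp [fundRegion, hξ.highestRoot_eq hα]
  rw [h, interior_inter, interior_iInter_of_finite,
    interior_setOf_inner_ge (neg_ne_zero.2 hξ0)]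
  simp only [interior_setOf_inner_ge (hα.ne_zero _)]
  ext a
  simp

theorem IsSimpleRootSystem.ext_inner (hα : IsSimpleRootSystem C α)
    {a b : EuclideanSpace ℝ (Fin n)} (h : ∀ i, ⟪a, α i⟫_ℝ = ⟪b, α i⟫_ℝ) : a = b := by
  refine ext_inner_right ℝ fun v => ?_
  have hv : v ∈ Submodule.span ℝ (Set.range α) := hα.span_eq_top ▸ Submodule.mem_top
  induction hv using Submodule.span_induction with
  | mem x hx => obtain ⟨i, rfl⟩ := hx; exact h i
  | zero => simp
  | add x y _ _ hx hy => rw [inner_add_right, inner_add_right, hx, hy]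
  | smul t x _ hx => rw [real_inner_smul_right, real_inner_smul_right, hx]

theorem IsSimpleRootSystem.exists_inner_eq (hα : IsSimpleRootSystem C α) (t : Fin n → ℝ) :
    ∃ a, ∀ i, ⟪a, α i⟫_ℝ = t i := by
  let L : EuclideanSpace ℝ (Fin n) →ₗ[ℝ] (Fin n → ℝ) :=
    LinearMap.pi fun i => (innerSL ℝ (α i)).toLinearMap
  have hL (a i) : L a i = ⟪a, α i⟫_ℝ := real_inner_comm a (α i)
  have hinj : Function.Injective L := fun a b hab =>
    hα.ext_inner fun i => by rw [← hL, hab, hL]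
  obtain ⟨a, ha⟩ := (LinearMap.injective_iff_surjective_of_finrank_eq_finrank (by simp)).1 hinj t
  exact ⟨a, fun i => by rw [← hL, ha]⟩

/-- The number of points of the even grid in terms of the coefficients of the highest root. -/
theorem IsDominatingRoot.ncard_evenGrid (hα : IsSimpleRootSystem C α) (hξ : IsDominatingRoot α ξ)
    {m : Fin n → ℕ} (hm : ∀ i, 1 ≤ m i) (hξm : ξ = ∑ i, m i • α i) (j : Fin n) {M : ℕ}
    (hM : 1 ≤ M) :
    (evenGrid α j M).ncard = {s : Fin n → ℕ | ∑ i, m i * s i ≤ M}.ncard +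
      {s : Fin n → ℕ | (∀ i, 1 ≤ s i) ∧ ∑ i, m i * s i < M}.ncard := by
  have hM0 : (0 : ℝ) < M := by exact_mod_cast hM
  -- `ψ s` is the point with coordinates `s i / M` with respect to the basis dual to the simple
  -- roots.
  choose ψ hψ using fun s : Fin n → ℕ => hα.exists_inner_eq fun i => (s i : ℝ) / M
  have hinner (a : EuclideanSpace ℝ (Fin n)) : ⟪a, ξ⟫_ℝ = ∑ i, m i * ⟪a, α i⟫_ℝ := by
    rw [hξm, inner_sum]
    refine Finset.sum_congr rfl fun i _ => ?_
    rw [← Nat.cast_smul_eq_nsmul ℝ, real_inner_smul_right]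
  have hψξ (s) : ⟪ψ s, ξ⟫_ℝ = ((∑ i, m i * s i : ℕ) : ℝ) / M := by
    rw [hinner]
    push_cast
    rw [Finset.sum_div]
    exact Finset.sum_congr rfl fun i _ => by rw [hψ, mul_div_assoc]
  have hψinj : Function.Injective ψ := by
    intro s t hst
    funext i
    have : (s i : ℝ) / M = t i / M := by rw [← hψ, ← hψ, hst]
    exact_mod_cast (div_left_inj' hM0.ne').1 this
  have hψ0 (s i) : 0 ≤ ⟪ψ s, α i⟫_ℝ := by rw [hψ]; positivity
  have hψP (s) : (M : ℝ) • ψ s ∈ dualWeightLattice α := fun i =>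
    ⟨s i, by rw [real_inner_smul_left, hψ, mul_div_cancel₀ _ hM0.ne', Int.cast_natCast]⟩
  have hψsurj (a : EuclideanSpace ℝ (Fin n)) (ha : ∀ i, 0 ≤ ⟪a, α i⟫_ℝ)
      (haP : (M : ℝ) • a ∈ dualWeightLattice α) : ∃ s, a = ψ s := by
    choose z hz using haP
    refine ⟨fun i => (z i).toNat, hα.ext_inner fun i => ?_⟩
    have h1 := hz i
    rw [real_inner_smul_left] at h1
    have h2 : 0 ≤ z i := by
      have : (0 : ℝ) ≤ z i := h1 ▸ mul_nonneg hM0.le (ha i)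
      exact_mod_cast this
    rw [hψ, eq_div_iff hM0.ne', mul_comm, h1]
    exact_mod_cast (Int.toNat_of_nonneg h2).symm
  set T₁ := {s : Fin n → ℕ | ∑ i, m i * s i ≤ M}
  set T₂ := {s : Fin n → ℕ | (∀ i, 1 ≤ s i) ∧ ∑ i, m i * s i < M}
  have hT₁ (s) : s ∈ T₁ ↔ ⟪ψ s, ξ⟫_ℝ ≤ 1 := by
    rw [hψξ, div_le_one hM0]
    exact_mod_cast Iff.rfl
  have hT₂ (s) : s ∈ T₂ ↔ (∀ i, 0 < ⟪ψ s, α i⟫_ℝ) ∧ ⟪ψ s, ξ⟫_ℝ < 1 := by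
    rw [hψξ, div_lt_one hM0]
    refine and_congr (forall_congr' fun i => ?_) (by exact_mod_cast Iff.rfl)
    rw [hψ, div_pos_iff_of_pos_right hM0, Nat.cast_pos]
    rfl
  have hfin : T₁.Finite := by
    refine (Set.Finite.pi' fun _ => Set.finite_Iic M).subset fun s hs i => ?_
    calc s i ≤ m i * s i := Nat.le_mul_of_pos_left _ (hm i)
      _ ≤ ∑ i, m i * s i := Finset.single_le_sum (f := fun i => m i * s i)
          (fun _ _ => Nat.zero_le _) (Finset.mem_univ i)
      _ ≤ M := hs
  have hfin₂ : T₂.Finite := hfin.subset fun s hs => hs.2.le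
  have hξ0 : ξ ≠ 0 := by
    rw [hξm]
    intro h0
    have := Fintype.linearIndependent_iff.1 hα.linearIndependent (fun i => (m i : ℝ))
      (by simpa only [Nat.cast_smul_eq_nsmul] using h0) j
    have h1 := hm j
    have : m j = 0 := by exact_mod_cast this
    omega
  have hF : fundRegion α = {a | (∀ i, 0 ≤ ⟪a, α i⟫_ℝ) ∧ ⟪a, ξ⟫_ℝ ≤ 1} := by
    rw [fundRegion, hξ.highestRoot_eq hα.linearIndependent]
  have hint := interior_fundRegion hα.linearIndependent hξ hξ0
  have hrP (a : EuclideanSpace ℝ (Fin n)) (h : (M : ℝ) • a ∈ dualWeightLattice α) :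
      (M : ℝ) • simpleReflection α j a ∈ dualWeightLattice α := by
    obtain ⟨z, hz⟩ := h j
    rw [← map_smul, simpleReflection_eq, hz, Int.cast_smul_eq_zsmul]
    exact sub_mem h (zsmul_mem (dualRootLattice_le hα (AddSubgroup.subset_closure ⟨j, rfl⟩)) _)
  let f : (Fin n → ℕ) → EuclideanSpace ℝ (Fin n) ⧸ dualRootLattice α :=
    fun s => QuotientAddGroup.mk (ψ s)
  let g : (Fin n → ℕ) → EuclideanSpace ℝ (Fin n) ⧸ dualRootLattice α :=
    fun s => QuotientAddGroup.mk (simpleReflection α j (ψ s))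
  have hgrid : evenGrid α j M = f '' T₁ ∪ g '' T₂ := by
    ext x
    constructor
    · rintro ⟨⟨a, ha, rfl⟩, b, hb, hab⟩
      -- The two representatives `a` and `b` of the coset may differ, but only by an element of
      -- `Q^∨`, which lies in `P^∨`.
      have hbP : (M : ℝ) • b ∈ dualWeightLattice α := by
        have h1 := dualRootLattice_le hα (QuotientAddGroup.eq.1 hab)
        have h2 : (M : ℝ) • b = (M : ℝ) • a - M • (-b + a) := by
          rw [← Nat.cast_smul_eq_nsmul ℝ, ← smul_sub]
          congr 1
          abel
        rw [h2]
        exact sub_mem ha (nsmul_mem h1 _)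
      rw [← hab]
      rcases hb with hb | ⟨c, hc, rfl⟩
      · rw [hF] at hb
        obtain ⟨s, rfl⟩ := hψsurj b hb.1 hbP
        exact Or.inl ⟨s, (hT₁ s).2 hb.2, rfl⟩
      · rw [hint] at hc
        have hcP := hrP _ hbP
        rw [simpleReflection_simpleReflection] at hcP
        obtain ⟨s, rfl⟩ := hψsurj c (fun i => (hc.1 i).le) hcP
        exact Or.inr ⟨s, (hT₂ s).2 hc, rfl⟩
    · rintro (⟨s, hs, rfl⟩ | ⟨s, hs, rfl⟩)
      · refine ⟨⟨_, hψP s, rfl⟩, _, Or.inl ?_, rfl⟩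
        rw [hF]
        exact ⟨hψ0 s, (hT₁ s).1 hs⟩
      · refine ⟨⟨_, hrP _ (hψP s), rfl⟩, _, Or.inr ⟨ψ s, ?_, rfl⟩, rfl⟩
        rw [hint]
        exact (hT₂ s).1 hs
  have hfinj : Set.InjOn f T₁ := by
    intro s hs t ht hst
    refine hψinj (hξ.eq_of_sub_mem hα (hψ0 _) ((hT₁ s).1 hs) (hψ0 _) ((hT₁ t).1 ht) ?_)
    rw [← neg_add_eq_sub]
    exact QuotientAddGroup.eq.1 hst.symm
  have hT₂₁ {s} (hs : s ∈ T₂) : s ∈ T₁ := hs.2.le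
  have hginj : Set.InjOn g T₂ := by
    intro s hs t ht hst
    have h1 := QuotientAddGroup.eq.1 hst.symm
    refine hψinj (hξ.eq_of_sub_mem hα (hψ0 _) ((hT₁ s).1 (hT₂₁ hs)) (hψ0 _)
      ((hT₁ t).1 (hT₂₁ ht)) ?_)
    rw [neg_add_eq_sub, ← map_sub] at h1
    obtain ⟨z, hz⟩ := dualRootLattice_le hα h1 j
    -- The reflection `r_j` preserves `Q^∨`, since it changes a vector of `Q^∨` by an integer
    -- multiple of the dual root; this undoes the reflection in `h1`.
    rw [← simpleReflection_simpleReflection (α := α) j (ψ s - ψ t), simpleReflection_eq, hz,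
      Int.cast_smul_eq_zsmul]
    have hj : dualRoot α j ∈ dualRootLattice α := AddSubgroup.subset_closure ⟨j, rfl⟩
    exact sub_mem h1 (zsmul_mem hj _)
  have hdisj : Disjoint (f '' T₁) (g '' T₂) := by
    rw [Set.disjoint_left]
    rintro _ ⟨s, hs, rfl⟩ ⟨t, ht, hst⟩
    have h1 := QuotientAddGroup.eq.1 hst
    rw [neg_add_eq_sub] at h1
    exact hξ.sub_simpleReflection_notMem hα j (hψ0 s) ((hT₁ s).1 hs) ((hT₂ t).1 ht).1
      ((hT₂ t).1 ht).2 h1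
  rw [hgrid, Set.ncard_union_eq hdisj (hfin.image _) (hfin₂.image _), hfinj.ncard_image,
    hginj.ncard_image]

end Region

/-! ### Counting solutions of the linear inequalities. -/

section Count

theorem finite_setOf_sum_add_le {m : Fin n → ℕ} (hm : ∀ i, 1 ≤ m i) (c M : ℕ) :
    {s : Fin n → ℕ | ∑ i, m i * s i + c ≤ M}.Finite := by
  refine (Set.Finite.pi' fun _ => Set.finite_Iic M).subset fun s hs i => ?_
  calc s i ≤ m i * s i := Nat.le_mul_of_pos_left _ (hm i)
    _ ≤ ∑ i, m i * s i := Finset.single_le_sum (f := fun i => m i * s i)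
        (fun _ _ => Nat.zero_le _) (Finset.mem_univ i)
    _ ≤ M := (Nat.le_add_right _ _).trans hs

/-- Pascal's rule: a solution either has first entry `0`, which leaves one variable fewer, or its
first entry can be lowered by one, which leaves a smaller bound. -/
theorem ncard_setOf_sum_le (n K : ℕ) :
    {s : Fin n → ℕ | ∑ i, s i ≤ K}.ncard = (n + K).choose n := by
  have hfin (n K : ℕ) : {s : Fin n → ℕ | ∑ i, s i ≤ K}.Finite := by
    simpa using finite_setOf_sum_add_le (n := n) (m := fun _ => 1) (fun _ => le_rfl) 0 K
  induction n generalizing K with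
  | zero => simp [Set.ncard_univ]
  | succ n ihn =>
    induction K with
    | zero =>
      have : {s : Fin (n + 1) → ℕ | ∑ i, s i ≤ 0} = {0} := by
        ext s
        simp [funext_iff]
      rw [this, Set.ncard_singleton, add_zero, Nat.choose_self]
    | succ K ihK =>
      have h : {s : Fin (n + 1) → ℕ | ∑ i, s i ≤ K + 1} =
          Fin.cons (α := fun _ => ℕ) 0 '' {s : Fin n → ℕ | ∑ i, s i ≤ K + 1} ∪
            (fun s => Fin.cons (α := fun _ => ℕ) (s 0 + 1) (Fin.tail s)) ''
              {s : Fin (n + 1) → ℕ | ∑ i, s i ≤ K} := by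
        ext s
        constructor
        · intro hs
          rw [Set.mem_ofPred_eq, Fin.sum_univ_succ] at hs
          rcases Nat.eq_zero_or_eq_succ_pred (s 0) with h0 | h0
          · refine Or.inl ⟨Fin.tail s, ?_, ?_⟩
            · rw [h0, zero_add] at hs
              exact hs
            · rw [← h0, Fin.cons_self_tail]
          · refine Or.inr ⟨Fin.cons (α := fun _ => ℕ) (s 0).pred (Fin.tail s), ?_, ?_⟩
            · simp only [Set.mem_ofPred_eq, Fin.sum_univ_succ, Fin.cons_zero, Fin.cons_succ]
              simp only [Fin.tail]
              omega
            · simp only [Fin.cons_zero, Fin.tail_cons]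
              conv_rhs => rw [← Fin.cons_self_tail s, h0]
        · rintro (⟨t, ht, rfl⟩ | ⟨t, ht, rfl⟩)
          · simpa [Fin.sum_univ_succ] using ht
          · simp only [Set.mem_ofPred_eq, Fin.sum_univ_succ, Fin.cons_zero, Fin.cons_succ,
              Fin.tail] at ht ⊢
            omega
      rw [h, Set.ncard_union_eq ?_ ((hfin _ _).image _) ((hfin _ _).image _),
        Set.ncard_image_of_injective _ (Fin.cons_right_injective _),
        Set.ncard_image_of_injective, ihn, ihK]
      · rw [show n + 1 + (K + 1) = (n + (K + 1)) + 1 by ring, Nat.choose_succ_succ,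
          show n + 1 + K = n + (K + 1) by ring]
      · intro s t hst
        have h1 := Fin.cons_injective2 hst
        rw [← Fin.cons_self_tail s, ← Fin.cons_self_tail t, h1.2, Nat.succ_injective h1.1]
      · rw [Set.disjoint_left]
        rintro _ ⟨s, -, rfl⟩ ⟨t, -, hst⟩
        exact absurd (Fin.cons_injective2 hst).1 (Nat.succ_ne_zero _)

/-- For `c > M` there are no solutions, and the truncated top index is below `n`, so the binomial
also vanishes. This needs `1 ≤ n`, as `Nat.choose 0 0 = 1`. -/
theorem ncard_setOf_sum_one_add_le (hn : 1 ≤ n) (c M : ℕ) :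
    {s : Fin n → ℕ | ∑ i, 1 * s i + c ≤ M}.ncard = (n + M - c).choose n := by
  simp only [one_mul]
  rcases le_or_gt c M with h | h
  · simp only [← Nat.le_sub_iff_add_le h]
    rw [ncard_setOf_sum_le, Nat.add_sub_assoc h]
  · rw [Nat.choose_eq_zero_of_lt (by omega)]
    convert Set.ncard_empty (Fin n → ℕ)
    refine Set.eq_empty_of_forall_notMem fun s hs => ?_
    rw [Set.mem_ofPred_eq] at hs
    omega

/-- Halving the inequality gives `∑ s_i ≤ (M - c) / 2`. Placing `2 * n` inside the floor makes the
binomial vanish when `c > M` as well. -/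
theorem ncard_setOf_sum_two_add_le (hn : 1 ≤ n) (c M : ℕ) :
    {s : Fin n → ℕ | ∑ i, 2 * s i + c ≤ M}.ncard = ((2 * n + M - c) / 2).choose n := by
  simp only [← Finset.mul_sum]
  rcases le_or_gt c M with h | h
  · have (a : ℕ) : 2 * a + c ≤ M ↔ a ≤ (M - c) / 2 := by omega
    simp only [this]
    rw [ncard_setOf_sum_le]
    congr 1
    omega
  · rw [Nat.choose_eq_zero_of_lt (by omega)]
    convert Set.ncard_empty (Fin n → ℕ)
    refine Set.eq_empty_of_forall_notMem fun s hs => ?_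
    rw [Set.mem_ofPred_eq] at hs
    omega

/-- Splitting a variable with coefficient `1` according to its parity. -/
theorem ncard_setOf_sum_add_le_split {m : Fin n → ℕ} (hm : ∀ i, 1 ≤ m i) {i : Fin n}
    (hi : m i = 1) (c M : ℕ) :
    {s : Fin n → ℕ | ∑ k, m k * s k + c ≤ M}.ncard =
      {s : Fin n → ℕ | ∑ k, Function.update m i 2 k * s k + c ≤ M}.ncard +
        {s : Fin n → ℕ | ∑ k, Function.update m i 2 k * s k + (c + 1) ≤ M}.ncard := by
  have hm' : ∀ k, 1 ≤ Function.update m i 2 k := by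
    intro k
    rcases eq_or_ne k i with rfl | hk
    · simp
    · rw [Function.update_of_ne hk]
      exact hm k
  -- Entry `i` is written as `2 * t i + r` with `r = 0` or `1`: its coefficient doubles and `r`
  -- joins the constant term.
  let φ (r : ℕ) (t : Fin n → ℕ) : Fin n → ℕ := Function.update t i (2 * t i + r)
  have hφ (r : ℕ) (t) : ∑ k, m k * φ r t k = ∑ k, Function.update m i 2 k * t k + r := by
    have : r = ∑ k, if k = i then r else 0 := by simp
    conv_rhs => rw [this]
    rw [← Finset.sum_add_distrib]
    refine Finset.sum_congr rfl fun k _ => ?_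
    rcases eq_or_ne k i with rfl | hk
    · simp [φ, hi]
    · simp [φ, hk]
  have hinj (r : ℕ) : Function.Injective (φ r) := by
    intro s t hst
    funext k
    have := congrFun hst k
    rcases eq_or_ne k i with rfl | hk
    · simp only [φ, Function.update_self] at this
      omega
    · simpa only [φ, Function.update_of_ne hk] using this
  have h : {s : Fin n → ℕ | ∑ k, m k * s k + c ≤ M} =
      φ 0 '' {s : Fin n → ℕ | ∑ k, Function.update m i 2 k * s k + c ≤ M} ∪
        φ 1 '' {s : Fin n → ℕ | ∑ k, Function.update m i 2 k * s k + (c + 1) ≤ M} := by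
    ext s
    constructor
    · intro hs
      rw [Set.mem_ofPred_eq] at hs
      have hs' : φ (s i % 2) (Function.update s i (s i / 2)) = s := by
        simp only [φ, Function.update_self, Function.update_idem, Nat.div_add_mod,
          Function.update_eq_self]
      rw [← hs', hφ] at hs
      rcases Nat.mod_two_eq_zero_or_one (s i) with h0 | h0
      · rw [h0] at hs hs'
        exact Or.inl ⟨_, by rw [Set.mem_ofPred_eq]; omega, hs'⟩
      · rw [h0] at hs hs'
        exact Or.inr ⟨_, by rw [Set.mem_ofPred_eq]; omega, hs'⟩
    · rintro (⟨t, ht, rfl⟩ | ⟨t, ht, rfl⟩) <;> rw [Set.mem_ofPred_eq] at ht ⊢ <;> rw [hφ] <;> omega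
  rw [h, Set.ncard_union_eq ?_ ((finite_setOf_sum_add_le hm' _ _).image _)
    ((finite_setOf_sum_add_le hm' _ _).image _), Set.ncard_image_of_injective _ (hinj 0),
    Set.ncard_image_of_injective _ (hinj 1)]
  rw [Set.disjoint_left]
  rintro _ ⟨s, -, rfl⟩ ⟨t, -, hst⟩
  have := congrFun hst i
  simp only [φ, Function.update_self] at this
  omega

/-- Substituting `s = t + 1` adds `∑ m_i` to the left side, and strictness of the inequality adds
the final `1`. -/
theorem ncard_setOf_pos_sum_lt (m : Fin n → ℕ) (M : ℕ) :
    {s : Fin n → ℕ | (∀ i, 1 ≤ s i) ∧ ∑ i, m i * s i < M}.ncard =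
      {s : Fin n → ℕ | ∑ i, m i * s i + (∑ i, m i + 1) ≤ M}.ncard := by
  rw [← Set.ncard_image_of_injective {s : Fin n → ℕ | ∑ i, m i * s i + (∑ i, m i + 1) ≤ M}
    (add_left_injective (1 : Fin n → ℕ))]
  refine congrArg Set.ncard ?_
  have hsum (t : Fin n → ℕ) : ∑ i, m i * (t + 1) i = ∑ i, m i * t i + ∑ i, m i := by
    simp [mul_add, Finset.sum_add_distrib]
  ext s
  constructor
  · rintro ⟨h1, h2⟩
    have hs : s - 1 + 1 = s := funext fun i => Nat.sub_add_cancel (h1 i)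
    refine ⟨s - 1, ?_, hs⟩
    rw [← hs, hsum] at h2
    rw [Set.mem_ofPred_eq]
    omega
  · rintro ⟨t, ht, rfl⟩
    refine ⟨fun i => Nat.le_add_left _ _, ?_⟩
    rw [Set.mem_ofPred_eq] at ht
    change ∑ i, m i * (t + 1) i < M
    rw [hsum]
    omega

theorem sum_update_two_one {i : Fin n} {m : Fin n → ℕ} (hi : m i = 2) :
    ∑ k, Function.update m i 1 k + 1 = ∑ k, m k := by
  rw [Finset.sum_update_of_mem (Finset.mem_univ i), Finset.sdiff_singleton_eq_erase,
    ← Finset.add_sum_erase _ m (Finset.mem_univ i), hi]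
  omega

/-- The count for a highest root with one coefficient `1` and all others `2`. -/
theorem ncard_add_ncard_of_one (hn : 1 ≤ n) (i : Fin n) (M : ℕ) {m : Fin n → ℕ}
    (hm : m = Function.update (fun _ => 2) i 1) :
    {s : Fin n → ℕ | ∑ i, m i * s i ≤ M}.ncard +
      {s : Fin n → ℕ | (∀ i, 1 ≤ s i) ∧ ∑ i, m i * s i < M}.ncard =
    ((2 * n + M) / 2).choose n + ((2 * n + M - 1) / 2).choose n +
      ((M / 2).choose n + ((M - 1) / 2).choose n) := by
  have hm1 : ∀ k, 1 ≤ m k := by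
    intro k
    rw [hm, Function.update_apply]
    split_ifs <;> omega
  have hi : m i = 1 := by simp [hm]
  have hu : Function.update m i 2 = fun _ => 2 := by
    rw [hm, Function.update_idem]
    exact Function.update_eq_self i (fun _ => 2)
  have hsum : ∑ k, m k + 1 = 2 * n := by
    rw [hm, sum_update_two_one rfl]
    simp [mul_comm]
  have key (c : ℕ) : {s : Fin n → ℕ | ∑ k, m k * s k + c ≤ M}.ncard =
      ((2 * n + M - c) / 2).choose n + ((2 * n + M - (c + 1)) / 2).choose n := by
    rw [ncard_setOf_sum_add_le_split hm1 hi, hu, ncard_setOf_sum_two_add_le hn,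
      ncard_setOf_sum_two_add_le hn]
  rw [ncard_setOf_pos_sum_lt, hsum, key]
  have := key 0
  simp only [add_zero] at this
  rw [this, Nat.sub_zero, zero_add, show 2 * n + M - 2 * n = M by omega,
    show 2 * n + M - (2 * n + 1) = M - 1 by omega]

/-- The count for a highest root with three coefficients `1` and all others `2`. -/
theorem ncard_add_ncard_of_three (hn : 1 ≤ n) {i j l : Fin n} (hij : i ≠ j) (hil : i ≠ l)
    (hjl : j ≠ l) (M : ℕ) {m : Fin n → ℕ}
    (hm : m = Function.update (Function.update (Function.update (fun _ => 2) l 1) j 1) i 1) :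
    {s : Fin n → ℕ | ∑ i, m i * s i ≤ M}.ncard +
      {s : Fin n → ℕ | (∀ i, 1 ≤ s i) ∧ ∑ i, m i * s i < M}.ncard =
    ((2 * n + M) / 2).choose n + 3 * ((2 * n + M - 1) / 2).choose n +
      3 * ((2 * n + M - 2) / 2).choose n + ((2 * n + M - 3) / 2).choose n +
    (((M + 2) / 2).choose n + 3 * ((M + 1) / 2).choose n + 3 * (M / 2).choose n +
      ((M - 1) / 2).choose n) := by
  have hm1 : ∀ k, 1 ≤ m k := by
    intro k
    simp only [hm, Function.update_apply]
    split_ifs <;> omega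
  have hi : m i = 1 := by simp [hm]
  have hm2 : ∀ k, 1 ≤ Function.update m i 2 k := by
    intro k
    rw [Function.update_apply]
    split_ifs
    · omega
    · exact hm1 k
  have hj : Function.update m i 2 j = 1 := by simp [hm, hij.symm]
  have hm3 : ∀ k, 1 ≤ Function.update (Function.update m i 2) j 2 k := by
    intro k
    rw [Function.update_apply]
    split_ifs
    · omega
    · exact hm2 k
  have hl : Function.update (Function.update m i 2) j 2 l = 1 := by
    simp [hm, hil.symm, hjl.symm]
  have hu : Function.update (Function.update (Function.update m i 2) j 2) l 2 = fun _ => 2 := by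
    funext k
    simp only [hm, Function.update_apply]
    split_ifs <;> rfl
  have hsum : ∑ k, m k + 1 = 2 * n - 2 := by
    have h1 := sum_update_two_one (m := fun _ : Fin n => 2) (i := l) rfl
    have h2 := sum_update_two_one (m := Function.update (fun _ : Fin n => 2) l 1) (i := j)
      (by simp [hjl])
    have h3 := sum_update_two_one
      (m := Function.update (Function.update (fun _ : Fin n => 2) l 1) j 1) (i := i)
      (by simp [hij, hil])
    rw [← hm] at h3
    simp only [Finset.sum_const, Finset.card_univ, Fintype.card_fin, smul_eq_mul] at h1
    omega
  have key (c : ℕ) : {s : Fin n → ℕ | ∑ k, m k * s k + c ≤ M}.ncard =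
      ((2 * n + M - c) / 2).choose n + 3 * ((2 * n + M - (c + 1)) / 2).choose n +
      3 * ((2 * n + M - (c + 2)) / 2).choose n + ((2 * n + M - (c + 3)) / 2).choose n := by
    rw [ncard_setOf_sum_add_le_split hm1 hi]
    simp only [ncard_setOf_sum_add_le_split hm2 hj, ncard_setOf_sum_add_le_split hm3 hl, hu,
      ncard_setOf_sum_two_add_le hn, add_assoc, Nat.reduceAdd]
    ring
  rw [ncard_setOf_pos_sum_lt, hsum, key]
  have := key 0
  simp only [add_zero, zero_add, Nat.sub_zero] at this
  rw [this, show 2 * n + M - (2 * n - 2) = M + 2 by omega,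
    show 2 * n + M - (2 * n - 2 + 1) = M + 1 by omega,
    show 2 * n + M - (2 * n - 2 + 2) = M by omega,
    show 2 * n + M - (2 * n - 2 + 3) = M - 1 by omega]

end Count

/-! ### Coordinates in which the roots are signed sums. -/

section Coordinates

variable {C : Matrix (Fin n) (Fin n) ℤ} {e : ℕ → EuclideanSpace ℝ (Fin n)}

theorem simpleReflection_eq' (i : Fin n) (a : EuclideanSpace ℝ (Fin n)) :
    simpleReflection α i a = a - ⟪a, dualRoot α i⟫_ℝ • α i := by
  rw [simpleReflection_apply, dualRoot, real_inner_smul_right]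
  congr 2
  ring

/-- Vectors with prescribed last member whose successive differences are simple roots. -/
theorem exists_chain (α : Fin n → EuclideanSpace ℝ (Fin n)) (b : EuclideanSpace ℝ (Fin n)) (N : ℕ) :
    ∃ e : ℕ → EuclideanSpace ℝ (Fin n), e N = b ∧
      ∀ k (hk : k < n), k < N → e k = α ⟨k, hk⟩ + e (k + 1) := by
  refine ⟨fun k => ∑ x ∈ Finset.Ico k N, (if h : x < n then α ⟨x, h⟩ else 0) + b, by simp, ?_⟩
  intro k hk hkN
  simp only [Finset.sum_eq_sum_Ico_succ_bot hkN, dif_pos hk, add_assoc]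

/-- Pairings with dual roots satisfy a recursion whose increments are Cartan integers, so the Cartan
matrix determines them without any knowledge of root lengths. -/
theorem inner_chain (hα : IsSimpleRootSystem C α) {N : ℕ} (hN : N ≤ n)
    (he : ∀ k (hk : k < n), k < N → e k = α ⟨k, hk⟩ + e (k + 1)) (i : Fin n) (f : ℕ → ℤ)
    (h0 : ⟪e N, dualRoot α i⟫_ℝ = f N)
    (hf : ∀ k (hk : k < n), k < N → f k = C ⟨k, hk⟩ i + f (k + 1)) :
    ∀ k ≤ N, ⟪e k, dualRoot α i⟫_ℝ = f k := by
  intro k hk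
  induction hk using Nat.decreasingInduction with
  | self => exact h0
  | of_succ k hk ih =>
    rw [he k (by omega) hk, inner_add_left, hα.inner_dualRoot, ih, hf k (by omega) hk]
    push_cast
    rfl

theorem sub_mem_positiveCone_of_le {N : ℕ}
    (he : ∀ k, k < N → ∃ i, α i = e k - e (k + 1)) {k l : ℕ} (hkl : k ≤ l) (hl : l ≤ N) :
    e k - e l ∈ positiveCone α := by
  induction l, hkl using Nat.le_induction with
  | base => rw [sub_self]; exact zero_mem _
  | succ l hkl ih =>
    obtain ⟨i, hi⟩ := he l (by omega)
    have := add_mem (ih (by omega)) (simple_mem_positiveCone (α := α) i)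
    rwa [hi, sub_add_sub_cancel] at this

/-- Vectors `e 0, …, e (n - 1)` with `αₖ = e k - e (k + 1)`, permuted by the reflections in these
simple roots. -/
structure IsFrame (α : Fin n → EuclideanSpace ℝ (Fin n)) (e : ℕ → EuclideanSpace ℝ (Fin n)) :
    Prop where
  simple : ∀ k (h : k + 1 < n), α ⟨k, by omega⟩ = e k - e (k + 1)
  inner : ∀ i (h : i + 1 < n), ∀ k < n, ⟪e k, dualRoot α ⟨i, by omega⟩⟫_ℝ =
    (((if k = i then 1 else 0) - (if k = i + 1 then 1 else 0) : ℤ) : ℝ)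

namespace IsFrame

theorem simpleReflection_apply (h : IsFrame α e) {i : ℕ} (hi : i + 1 < n) {k : ℕ} (hk : k < n) :
    simpleReflection α ⟨i, by omega⟩ (e k) = e (Equiv.swap i (i + 1) k) := by
  rw [simpleReflection_eq', h.inner i hi k hk, h.simple i hi]
  rcases eq_or_ne k i with rfl | h1
  · simp
  · rcases eq_or_ne k (i + 1) with rfl | h2
    · simp
    · rw [Equiv.swap_apply_of_ne_of_ne h1 h2]
      simp [h1, h2]

theorem sub_mem (h : IsFrame α e) {k l : ℕ} (hkl : k ≤ l) (hl : l < n) :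
    e k - e l ∈ positiveCone α :=
  sub_mem_positiveCone_of_le (N := n - 1) (fun k hk => ⟨_, h.simple k (by omega)⟩) hkl (by omega)

end IsFrame

/-- A map that permutes the vectors `e 0, …, e (n - 1)` up to signs. -/
def IsSignedPerm (e : ℕ → EuclideanSpace ℝ (Fin n))
    (r : EuclideanSpace ℝ (Fin n) ≃ₗᵢ[ℝ] EuclideanSpace ℝ (Fin n)) : Prop :=
  ∃ (σ : Equiv.Perm ℕ) (w : ℕ → ℤˣ), ∀ k < n, σ k < n ∧ r (e k) = w k • e (σ k)

theorem IsFrame.isSignedPerm (h : IsFrame α e) {i : ℕ} (hi : i + 1 < n) :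
    IsSignedPerm e (simpleReflection α ⟨i, by omega⟩) := by
  refine ⟨Equiv.swap i (i + 1), fun _ => 1, fun k hk => ⟨?_, ?_⟩⟩
  · rw [Equiv.swap_apply_def]
    split_ifs <;> omega
  · rw [h.simpleReflection_apply hi hk, one_smul]

/-- All simple reflections but the last are transpositions in a frame; only the last one
distinguishes types B, C and D. -/
theorem IsFrame.isSignedPerm_of_last (h : IsFrame α e) (hn : 1 ≤ n)
    (hlast : IsSignedPerm e (simpleReflection α ⟨n - 1, by omega⟩)) (i : Fin n) :
    IsSignedPerm e (simpleReflection α i) := by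
  by_cases hi : i.val + 1 < n
  · exact h.isSignedPerm hi
  · have : i = ⟨n - 1, by omega⟩ := Fin.ext (by simp only; omega)
    rw [this]
    exact hlast

/-- The vectors `± e k ± e l` with `k ≠ l`. -/
def signedPairs (e : ℕ → EuclideanSpace ℝ (Fin n)) : Set (EuclideanSpace ℝ (Fin n)) :=
  {β | ∃ k < n, ∃ l < n, ∃ u v : ℤˣ, k < l ∧ β = u • e k + v • e l}

/-- The vectors `± c (e k)`. -/
def signedSingles (e : ℕ → EuclideanSpace ℝ (Fin n)) (c : ℕ) : Set (EuclideanSpace ℝ (Fin n)) :=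
  {β | ∃ k < n, ∃ u : ℤˣ, β = c • u • e k}

theorem map_units_smul (r : EuclideanSpace ℝ (Fin n) ≃ₗᵢ[ℝ] EuclideanSpace ℝ (Fin n)) (u : ℤˣ)
    (v : EuclideanSpace ℝ (Fin n)) : r (u • v) = u • r v := by
  rw [Units.smul_def, Units.smul_def, map_zsmul]

theorem IsSignedPerm.map_mem_signedPairs
    {r : EuclideanSpace ℝ (Fin n) ≃ₗᵢ[ℝ] EuclideanSpace ℝ (Fin n)} (hr : IsSignedPerm e r)
    {β : EuclideanSpace ℝ (Fin n)} (hβ : β ∈ signedPairs e) : r β ∈ signedPairs e := by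
  obtain ⟨σ, w, h⟩ := hr
  obtain ⟨k, hk, l, hl, u, v, hkl, rfl⟩ := hβ
  rw [map_add, map_units_smul, map_units_smul, (h k hk).2, (h l hl).2, smul_smul, smul_smul]
  rcases lt_or_gt_of_ne (σ.injective.ne hkl.ne) with h1 | h1
  · exact ⟨_, (h k hk).1, _, (h l hl).1, _, _, h1, rfl⟩
  · exact ⟨_, (h l hl).1, _, (h k hk).1, _, _, h1, add_comm _ _⟩

theorem IsSignedPerm.map_mem_signedSingles {c : ℕ}
    {r : EuclideanSpace ℝ (Fin n) ≃ₗᵢ[ℝ] EuclideanSpace ℝ (Fin n)} (hr : IsSignedPerm e r)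
    {β : EuclideanSpace ℝ (Fin n)} (hβ : β ∈ signedSingles e c) : r β ∈ signedSingles e c := by
  obtain ⟨σ, w, h⟩ := hr
  obtain ⟨k, hk, u, rfl⟩ := hβ
  rw [map_nsmul, map_units_smul, (h k hk).2, smul_smul]
  exact ⟨_, (h k hk).1, _, rfl⟩

theorem IsFrame.simple_mem_signedPairs (h : IsFrame α e) {k : ℕ} (hk : k + 1 < n) :
    α ⟨k, by omega⟩ ∈ signedPairs e :=
  ⟨k, by omega, k + 1, hk, 1, -1, by omega, by
    rw [h.simple k hk, one_smul, Units.neg_smul, one_smul, sub_eq_add_neg]⟩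

/-- The frames in which the sums `e k + e l`, `k ≠ l`, are positive. -/
structure IsPositiveFrame (α : Fin n → EuclideanSpace ℝ (Fin n))
    (e : ℕ → EuclideanSpace ℝ (Fin n)) : Prop extends IsFrame α e where
  add_mem : ∀ k l, k < l → l < n → e k + e l ∈ positiveCone α

theorem pos_or_neg_of_mem_signedSingles {c : ℕ}
    (hc : ∀ k < n, c • e k ∈ positiveCone α) {β : EuclideanSpace ℝ (Fin n)}
    (hβ : β ∈ signedSingles e c) : β ∈ positiveCone α ∨ -β ∈ positiveCone α := by
  obtain ⟨k, hk, u, rfl⟩ := hβ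
  rcases Int.units_eq_one_or u with rfl | rfl
  · rw [one_smul]
    exact Or.inl (hc k hk)
  · rw [Units.neg_smul, one_smul, smul_neg, neg_neg]
    exact Or.inr (hc k hk)

namespace IsPositiveFrame

theorem add_smul_mem (h : IsPositiveFrame α e) {k l : ℕ} (hkl : k ≤ l) (hl : l < n)
    (hk : k + 1 < n) (u : ℤˣ) : e k + u • e l ∈ positiveCone α := by
  rcases Int.units_eq_one_or u with rfl | rfl
  · rw [one_smul]
    rcases hkl.lt_or_eq with hkl | rfl
    · exact h.add_mem k l hkl hl
    -- `2 e_k = (e_k - e_{k+1}) + (e_k + e_{k+1})`. The index `k + 1` must exist: in type D, `2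
    -- e_{n-1}` is not in the cone.
    · have := AddMemClass.add_mem (h.sub_mem (Nat.le_succ k) hk) (h.add_mem k (k + 1) (by omega) hk)
      rwa [show e k - e (k + 1) + (e k + e (k + 1)) = e k + e k by abel] at this
  · rw [Units.neg_smul, one_smul, ← sub_eq_add_neg]
    exact h.sub_mem hkl hl

theorem pos_or_neg_of_mem_signedPairs (h : IsPositiveFrame α e) {β : EuclideanSpace ℝ (Fin n)}
    (hβ : β ∈ signedPairs e) : β ∈ positiveCone α ∨ -β ∈ positiveCone α := by
  obtain ⟨k, hk, l, hl, u, v, hkl, rfl⟩ := hβ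
  rcases Int.units_eq_one_or u with rfl | rfl
  · rw [one_smul]
    exact Or.inl (h.add_smul_mem hkl.le hl (by omega) v)
  · rw [Units.neg_smul, one_smul, neg_add, neg_neg, ← Units.neg_smul]
    exact Or.inr (h.add_smul_mem hkl.le hl (by omega) (-v))

theorem sub_smul_mem (h : IsPositiveFrame α e) {k l : ℕ} (hkl : k ≤ l) (hl : l < n)
    (hk : k + 1 < n) (u : ℤˣ) : e k - u • e l ∈ positiveCone α := by
  rw [sub_eq_add_neg, ← Units.neg_smul]
  exact h.add_smul_mem hkl hl hk _

theorem zero_add_one_sub_mem (h : IsPositiveFrame α e) (hn : 3 ≤ n)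
    {β : EuclideanSpace ℝ (Fin n)} (hβ : β ∈ signedPairs e) :
    e 0 + e 1 - β ∈ positiveCone α := by
  obtain ⟨k, hk, l, hl, u, v, hkl, rfl⟩ := hβ
  rw [add_sub_add_comm]
  -- Since `k < l` forces `1 ≤ l`, `e 0` can be matched with `e k` and `e 1` with `e l`.
  exact AddMemClass.add_mem (h.sub_smul_mem (Nat.zero_le k) hk (by omega) u)
    (h.sub_smul_mem (by omega) hl (by omega) v)

theorem two_smul_sub_mem (h : IsPositiveFrame α e) (hn : 2 ≤ n)
    {β : EuclideanSpace ℝ (Fin n)} (hβ : β ∈ signedPairs e) :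
    2 • e 0 - β ∈ positiveCone α := by
  obtain ⟨k, hk, l, hl, u, v, hkl, rfl⟩ := hβ
  rw [two_nsmul, add_sub_add_comm]
  exact AddMemClass.add_mem (h.sub_smul_mem (Nat.zero_le k) hk (by omega) u)
    (h.sub_smul_mem (Nat.zero_le l) hl (by omega) v)

end IsPositiveFrame

theorem IsFrame.zero_add_one_mem_roots (h : IsFrame α e) (hn : 2 ≤ n)
    (h0 : e (n - 2) + e (n - 1) ∈ roots α) : e 0 + e 1 ∈ roots α := by
  have key : ∀ k ≤ n - 2, e k + e (k + 1) ∈ roots α := by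
    intro k hk
    induction hk using Nat.decreasingInduction with
    | self => rwa [show n - 2 + 1 = n - 1 by omega]
    | of_succ k hk ih =>
      -- Applying `r_k` and then `r_{k+1}` moves the index pair `(k+1, k+2)` to `(k, k+2)` and then
      -- to `(k, k+1)`.
      have h1 := simpleReflection_mem_roots ⟨k + 1, by omega⟩
        (simpleReflection_mem_roots ⟨k, by omega⟩ ih)
      have e1 : Equiv.swap k (k + 1) (k + 1 + 1) = k + 1 + 1 :=
        Equiv.swap_apply_of_ne_of_ne (by omega) (by omega)
      have e2 : Equiv.swap (k + 1) (k + 1 + 1) k = k :=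
        Equiv.swap_apply_of_ne_of_ne (by omega) (by omega)
      rwa [map_add, h.simpleReflection_apply (by omega) (by omega),
        h.simpleReflection_apply (by omega) (by omega), Equiv.swap_apply_right, e1, map_add,
        h.simpleReflection_apply (by omega) (by omega),
        h.simpleReflection_apply (by omega) (by omega), Equiv.swap_apply_right, e2] at h1
  exact key 0 (Nat.zero_le _)

theorem IsFrame.smul_zero_mem_roots (h : IsFrame α e) (hn : 1 ≤ n) {c : ℕ}
    (h0 : c • e (n - 1) ∈ roots α) : c • e 0 ∈ roots α := by
  have key : ∀ k ≤ n - 1, c • e k ∈ roots α := by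
    intro k hk
    induction hk using Nat.decreasingInduction with
    | self => exact h0
    | of_succ k hk ih =>
      have h1 := simpleReflection_mem_roots ⟨k, by omega⟩ ih
      rwa [map_nsmul, h.simpleReflection_apply (by omega) (by omega),
        Equiv.swap_apply_right] at h1
  exact key 0 (Nat.zero_le _)

theorem IsFrame.sum_simple (h : IsFrame α e) (hn : 1 ≤ n) :
    ∑ i, α i = e 0 - e (n - 1) + α ⟨n - 1, by omega⟩ := by
  obtain ⟨p, rfl⟩ : ∃ p, n = p + 1 := ⟨n - 1, by omega⟩
  rw [Fin.sum_univ_castSucc]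
  congr 1
  rw [Nat.add_sub_cancel, ← Finset.sum_range_sub', ← Fin.sum_univ_eq_sum_range
    (fun i => e i - e (i + 1)) p]
  exact Finset.sum_congr rfl fun i _ => h.simple i (by omega)

theorem sum_update_one_smul {m : Fin n → ℕ} {i : Fin n} (hi : m i = 2)
    (α : Fin n → EuclideanSpace ℝ (Fin n)) :
    ∑ k, Function.update m i 1 k • α k = ∑ k, m k • α k - α i := by
  rw [← Finset.add_sum_erase _ _ (Finset.mem_univ i), ← Finset.add_sum_erase _
    (fun k => m k • α k) (Finset.mem_univ i), Function.update_self, hi, one_smul, two_nsmul,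
    add_sub_right_comm, add_sub_cancel_right]
  congr 1
  exact Finset.sum_congr rfl fun k hk => by rw [Function.update_of_ne (Finset.ne_of_mem_erase hk)]

end Coordinates

/-! ### Type B. -/

section TypeB

theorem exists_frame_B (hn : 2 ≤ n) (hα : IsSimpleRootSystem (CartanMatrix.B n) α) :
    ∃ e, IsFrame α e ∧ α ⟨n - 1, by omega⟩ = e (n - 1) ∧ ∀ k < n,
      simpleReflection α ⟨n - 1, by omega⟩ (e k) = (if k = n - 1 then -1 else 1 : ℤˣ) • e k := by
  obtain ⟨e, he0, he⟩ := exists_chain α (α ⟨n - 1, by omega⟩) (n - 1)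
  refine ⟨e, ⟨fun k hk => by rw [he k (by omega) (by omega), add_sub_cancel_right], ?_⟩,
    he0.symm, ?_⟩
  · intro i hi k hk
    refine inner_chain hα (by omega) he ⟨i, by omega⟩
      (fun k => (if k = i then 1 else 0) - (if k = i + 1 then 1 else 0)) ?_ ?_ k (by omega)
    · rw [he0, hα.inner_dualRoot]
      simp only [CartanMatrix.B, Matrix.of_apply, Fin.mk.injEq]
      congr 1
      grind
    · intro k hk hk'
      simp only [CartanMatrix.B, Matrix.of_apply, Fin.mk.injEq]
      grind
  · intro k hk
    rw [simpleReflection_eq', inner_chain hα (by omega) he ⟨n - 1, by omega⟩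
      (fun k => if k = n - 1 then 2 else 0) ?_ ?_ k (by omega), ← he0]
    · split_ifs with h
      · subst h
        rw [Units.neg_smul, one_smul]
        push_cast
        module
      · simp
    · rw [he0, hα.inner_dualRoot]
      simp
    · intro k hk hk'
      simp only [CartanMatrix.B, Matrix.of_apply, Fin.mk.injEq]
      grind

/-- The highest root is `e 0 + e 1 = 2 ∑ α_i - α_0`, as `∑ α_i` telescopes to `e 0`. An upper bound
for the set of roots suffices, together with the fact that `e 0 + e 1` is a root. -/
theorem ncard_evenGrid_B (hn : 3 ≤ n) (hα : IsSimpleRootSystem (CartanMatrix.B n) α) (j : Fin n)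
    {M : ℕ} (hM : 1 ≤ M) :
    (evenGrid α j M).ncard = ((2 * n + M) / 2).choose n + ((2 * n + M - 1) / 2).choose n +
      ((M / 2).choose n + ((M - 1) / 2).choose n) := by
  obtain ⟨e, h, hlast, hr⟩ := exists_frame_B (by omega) hα
  have hpos : ∀ k < n, e k ∈ positiveCone α := by
    intro k hk
    have := add_mem (h.sub_mem (show k ≤ n - 1 by omega) (by omega))
      (simple_mem_positiveCone (α := α) ⟨n - 1, by omega⟩)
    rwa [hlast, sub_add_cancel] at this
  have hp : IsPositiveFrame α e :=
    ⟨h, fun k l hkl hl => add_mem (hpos k (hkl.trans hl)) (hpos l hl)⟩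
  have hs := h.isSignedPerm_of_last (by omega)
    ⟨1, fun k => if k = n - 1 then -1 else 1, fun k hk => ⟨hk, hr k hk⟩⟩
  have hroots : roots α ⊆ signedPairs e ∪ signedSingles e 1 := by
    refine roots_subset (fun i => ?_) fun i β hβ => ?_
    · by_cases hi : i.val + 1 < n
      · exact Or.inl (h.simple_mem_signedPairs hi)
      · have : i = ⟨n - 1, by omega⟩ := Fin.ext (by simp only; omega)
        exact Or.inr ⟨n - 1, by omega, 1, by rw [one_smul, one_smul, this, hlast]⟩
    · exact hβ.imp (hs i).map_mem_signedPairs (hs i).map_mem_signedSingles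
  have hξ : IsDominatingRoot α (e 0 + e 1) := by
    refine ⟨h.zero_add_one_mem_roots (by omega) ?_, fun β hβ => ?_, fun β hβ => ?_⟩
    -- The last reflection flips the sign of `e (n - 1)`, turning `α_{n-2} = e (n - 2) - e (n - 1)`
    -- into the sum.
    · have h1 := simpleReflection_mem_roots ⟨n - 1, by omega⟩
        (simple_mem_roots (α := α) ⟨n - 2, by omega⟩)
      rw [h.simple (n - 2) (by omega), show n - 2 + 1 = n - 1 by omega, map_sub,
        hr _ (by omega), hr _ (by omega), if_neg (by omega), if_pos rfl, one_smul,
        Units.neg_smul, one_smul, sub_neg_eq_add] at h1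
      exact h1
    · rcases hroots hβ with hβ | hβ
      · exact hp.pos_or_neg_of_mem_signedPairs hβ
      · exact pos_or_neg_of_mem_signedSingles (fun k hk => by rw [one_smul]; exact hpos k hk) hβ
    · rcases hroots hβ with hβ | ⟨k, hk, u, rfl⟩
      · exact hp.zero_add_one_sub_mem hn hβ
      · rw [one_smul, add_sub_right_comm]
        exact add_mem (hp.sub_smul_mem (Nat.zero_le k) hk (by omega) u) (hpos 1 (by omega))
  have hm : ∀ i, 1 ≤ Function.update (fun _ : Fin n => 2) ⟨0, by omega⟩ 1 i := by
    intro i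
    rw [Function.update_apply]
    split_ifs <;> omega
  rw [hξ.ncard_evenGrid hα hm ?_ j hM]
  · exact ncard_add_ncard_of_one (by omega) _ M rfl
  · rw [sum_update_one_smul rfl, ← Finset.smul_sum, h.sum_simple (by omega), hlast,
      h.simple 0 (by omega)]
    module

end TypeB

/-! ### Type C. -/

section TypeC

theorem exists_frame_C (hn : 2 ≤ n) (hα : IsSimpleRootSystem (CartanMatrix.C n) α) :
    ∃ e, IsFrame α e ∧ α ⟨n - 1, by omega⟩ = 2 • e (n - 1) ∧ ∀ k < n,
      simpleReflection α ⟨n - 1, by omega⟩ (e k) = (if k = n - 1 then -1 else 1 : ℤˣ) • e k := by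
  -- The last simple root is the long one, `2 e_{n-1}`, so the chain ends in half of it.
  obtain ⟨e, he0, he⟩ := exists_chain α ((2⁻¹ : ℝ) • α ⟨n - 1, by omega⟩) (n - 1)
  have hlast : α ⟨n - 1, by omega⟩ = 2 • e (n - 1) := by
    rw [he0]
    module
  refine ⟨e, ⟨fun k hk => by rw [he k (by omega) (by omega), add_sub_cancel_right], ?_⟩,
    hlast, ?_⟩
  · intro i hi k hk
    refine inner_chain hα (by omega) he ⟨i, by omega⟩
      (fun k => (if k = i then 1 else 0) - (if k = i + 1 then 1 else 0)) ?_ ?_ k (by omega)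
    · rw [he0, real_inner_smul_left, hα.inner_dualRoot, inv_mul_eq_iff_eq_mul₀ two_ne_zero]
      simp only [CartanMatrix.C, Matrix.of_apply, Fin.mk.injEq]
      norm_cast
      grind
    · intro k hk hk'
      simp only [CartanMatrix.C, Matrix.of_apply, Fin.mk.injEq]
      grind
  · intro k hk
    rw [simpleReflection_eq', inner_chain hα (by omega) he ⟨n - 1, by omega⟩
      (fun k => if k = n - 1 then 1 else 0) ?_ ?_ k (by omega), hlast]
    · split_ifs with h
      · subst h
        rw [Units.neg_smul, one_smul]
        push_cast
        module
      · simp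
    · rw [he0, real_inner_smul_left, hα.inner_dualRoot]
      simp
    · intro k hk hk'
      simp only [CartanMatrix.C, Matrix.of_apply, Fin.mk.injEq]
      grind

/-- The highest root is `2 e_0 = 2 ∑ α_i - α_{n-1}`. The single coefficient `1` sits at the other
end than in type B, which does not affect the count. -/
theorem ncard_evenGrid_C (hn : 2 ≤ n) (hα : IsSimpleRootSystem (CartanMatrix.C n) α) (j : Fin n)
    {M : ℕ} (hM : 1 ≤ M) :
    (evenGrid α j M).ncard = ((2 * n + M) / 2).choose n + ((2 * n + M - 1) / 2).choose n +
      ((M / 2).choose n + ((M - 1) / 2).choose n) := by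
  obtain ⟨e, h, hlast, hr⟩ := exists_frame_C hn hα
  have hsub : ∀ k < n, e k - e (n - 1) ∈ positiveCone α := fun k hk =>
    h.sub_mem (by omega) (by omega)
  have hadd : ∀ k < n, ∀ l < n, e k + e l ∈ positiveCone α := by
    intro k hk l hl
    have := add_mem (add_mem (hsub k hk) (hsub l hl))
      (simple_mem_positiveCone (α := α) ⟨n - 1, by omega⟩)
    rw [hlast] at this
    convert this using 1
    module
  have hp : IsPositiveFrame α e := ⟨h, fun k l hkl hl => hadd k (hkl.trans hl) l hl⟩
  have hs := h.isSignedPerm_of_last (by omega)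
    ⟨1, fun k => if k = n - 1 then -1 else 1, fun k hk => ⟨hk, hr k hk⟩⟩
  have hroots : roots α ⊆ signedPairs e ∪ signedSingles e 2 := by
    refine roots_subset (fun i => ?_) fun i β hβ => ?_
    · by_cases hi : i.val + 1 < n
      · exact Or.inl (h.simple_mem_signedPairs hi)
      · have : i = ⟨n - 1, by omega⟩ := Fin.ext (by simp only; omega)
        exact Or.inr ⟨n - 1, by omega, 1, by rw [one_smul, this, hlast]⟩
    · exact hβ.imp (hs i).map_mem_signedPairs (hs i).map_mem_signedSingles
  have hξ : IsDominatingRoot α (2 • e 0) := by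
    refine ⟨h.smul_zero_mem_roots (by omega) (hlast ▸ simple_mem_roots _), fun β hβ => ?_,
      fun β hβ => ?_⟩
    · rcases hroots hβ with hβ | hβ
      · exact hp.pos_or_neg_of_mem_signedPairs hβ
      · exact pos_or_neg_of_mem_signedSingles
          (fun k hk => by rw [two_nsmul]; exact hadd k hk k hk) hβ
    · rcases hroots hβ with hβ | ⟨k, hk, u, rfl⟩
      · exact hp.two_smul_sub_mem hn hβ
      · rw [← smul_sub]
        exact nsmul_mem (hp.sub_smul_mem (Nat.zero_le k) hk (by omega) u) 2
  have hm : ∀ i, 1 ≤ Function.update (fun _ : Fin n => 2) ⟨n - 1, by omega⟩ 1 i := by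
    intro i
    rw [Function.update_apply]
    split_ifs <;> omega
  rw [hξ.ncard_evenGrid hα hm ?_ j hM]
  · exact ncard_add_ncard_of_one (by omega) _ M rfl
  · rw [sum_update_one_smul rfl, ← Finset.smul_sum, h.sum_simple (by omega), hlast]
    module

end TypeC

/-! ### Type D. -/

section TypeD

theorem exists_frame_D (hn : 4 ≤ n) (hα : IsSimpleRootSystem (CartanMatrix.D n) α) :
    ∃ e, IsFrame α e ∧ α ⟨n - 1, by omega⟩ = e (n - 2) + e (n - 1) ∧ ∀ k < n,
      simpleReflection α ⟨n - 1, by omega⟩ (e k) =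
        (if n - 2 ≤ k then -1 else 1 : ℤˣ) • e (Equiv.swap (n - 2) (n - 1) k) := by
  -- The end of the chain solves `e (n - 2) - e (n - 1) = α_{n-2}` and `e (n - 2) + e (n - 1) =
  -- α_{n-1}` for `e (n - 1)`.
  obtain ⟨e, he0, he⟩ := exists_chain α
    ((2⁻¹ : ℝ) • (α ⟨n - 1, by omega⟩ - α ⟨n - 2, by omega⟩)) (n - 1)
  have hlast : α ⟨n - 1, by omega⟩ = e (n - 2) + e (n - 1) := by
    rw [he (n - 2) (by omega) (by omega), show n - 2 + 1 = n - 1 by omega, he0]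
    module
  refine ⟨e, ⟨fun k hk => by rw [he k (by omega) (by omega), add_sub_cancel_right], ?_⟩,
    hlast, ?_⟩
  · intro i hi k hk
    refine inner_chain hα (by omega) he ⟨i, by omega⟩
      (fun k => (if k = i then 1 else 0) - (if k = i + 1 then 1 else 0)) ?_ ?_ k (by omega)
    · rw [he0, real_inner_smul_left, inner_sub_left, hα.inner_dualRoot, hα.inner_dualRoot,
        inv_mul_eq_iff_eq_mul₀ two_ne_zero]
      simp only [CartanMatrix.D, Matrix.of_apply, Fin.mk.injEq]
      norm_cast
      grind
    · intro k hk hk'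
      simp only [CartanMatrix.D, Matrix.of_apply, Fin.mk.injEq]
      grind
  · intro k hk
    rw [simpleReflection_eq', inner_chain hα (by omega) he ⟨n - 1, by omega⟩
      (fun k => if n - 2 ≤ k then 1 else 0) ?_ ?_ k (by omega), hlast]
    · split_ifs with h
      · rw [Units.neg_smul, one_smul, Int.cast_one, one_smul]
        obtain rfl | rfl : k = n - 2 ∨ k = n - 1 := by omega
        · rw [Equiv.swap_apply_left]
          module
        · rw [Equiv.swap_apply_right]
          module
      · rw [Equiv.swap_apply_of_ne_of_ne (by omega) (by omega)]
        simp
    · rw [he0, real_inner_smul_left, inner_sub_left, hα.inner_dualRoot, hα.inner_dualRoot,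
        inv_mul_eq_iff_eq_mul₀ two_ne_zero]
      simp only [CartanMatrix.D, Matrix.of_apply, Fin.mk.injEq]
      norm_cast
      grind
    · intro k hk hk'
      simp only [CartanMatrix.D, Matrix.of_apply, Fin.mk.injEq]
      grind

/-- The highest root is `e 0 + e 1 = 2 ∑ α_i - α_0 - α_{n-2} - α_{n-1}`: the coefficients `1` belong
to the three ends of the Dynkin diagram. -/
theorem ncard_evenGrid_D (hn : 4 ≤ n) (hα : IsSimpleRootSystem (CartanMatrix.D n) α) (j : Fin n)
    {M : ℕ} (hM : 1 ≤ M) :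
    (evenGrid α j M).ncard =
      ((2 * n + M) / 2).choose n + 3 * ((2 * n + M - 1) / 2).choose n +
        3 * ((2 * n + M - 2) / 2).choose n + ((2 * n + M - 3) / 2).choose n +
      (((M + 2) / 2).choose n + 3 * ((M + 1) / 2).choose n + 3 * (M / 2).choose n +
        ((M - 1) / 2).choose n) := by
  obtain ⟨e, h, hlast, hr⟩ := exists_frame_D hn hα
  have hp : IsPositiveFrame α e := by
    refine ⟨h, fun k l hkl hl => ?_⟩
    have := add_mem (add_mem (h.sub_mem (show k ≤ n - 2 by omega) (by omega))
      (h.sub_mem (show l ≤ n - 1 by omega) (by omega)))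
      (simple_mem_positiveCone (α := α) ⟨n - 1, by omega⟩)
    rw [hlast] at this
    convert this using 1
    module
  have hs := h.isSignedPerm_of_last (by omega)
    ⟨Equiv.swap (n - 2) (n - 1), fun k => if n - 2 ≤ k then -1 else 1, fun k hk => ⟨by
      rw [Equiv.swap_apply_def]
      split_ifs <;> omega, hr k hk⟩⟩
  have hroots : roots α ⊆ signedPairs e := by
    refine roots_subset (fun i => ?_) fun i β hβ => (hs i).map_mem_signedPairs hβ
    by_cases hi : i.val + 1 < n
    · exact h.simple_mem_signedPairs hi
    · have : i = ⟨n - 1, by omega⟩ := Fin.ext (by simp only; omega)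
      exact ⟨n - 2, by omega, n - 1, by omega, 1, 1, by omega, by
        rw [one_smul, one_smul, this, hlast]⟩
  have hξ : IsDominatingRoot α (e 0 + e 1) :=
    ⟨h.zero_add_one_mem_roots (by omega) (hlast ▸ simple_mem_roots _),
      fun β hβ => hp.pos_or_neg_of_mem_signedPairs (hroots hβ),
      fun β hβ => hp.zero_add_one_sub_mem (by omega) (hroots hβ)⟩
  have h1 : (⟨0, by omega⟩ : Fin n) ≠ ⟨n - 2, by omega⟩ := by
    rw [Ne, Fin.mk.injEq]; omega
  have h2 : (⟨0, by omega⟩ : Fin n) ≠ ⟨n - 1, by omega⟩ := by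
    rw [Ne, Fin.mk.injEq]; omega
  have h3 : (⟨n - 2, by omega⟩ : Fin n) ≠ ⟨n - 1, by omega⟩ := by
    rw [Ne, Fin.mk.injEq]; omega
  have hm : ∀ i, 1 ≤ Function.update (Function.update (Function.update (fun _ : Fin n => 2)
      ⟨n - 1, by omega⟩ 1) ⟨n - 2, by omega⟩ 1) ⟨0, by omega⟩ 1 i := by
    intro i
    simp only [Function.update_apply]
    split_ifs <;> omega
  rw [hξ.ncard_evenGrid hα hm ?_ j hM]
  · exact ncard_add_ncard_of_three (by omega) h1 h2 h3 M rfl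
  · rw [sum_update_one_smul (by rw [Function.update_of_ne h1, Function.update_of_ne h2]),
      sum_update_one_smul (by rw [Function.update_of_ne h3]), sum_update_one_smul rfl,
      ← Finset.smul_sum, h.sum_simple (by omega), hlast, h.simple 0 (by omega),
      h.simple (n - 2) (by omega), show n - 2 + 1 = n - 1 by omega]
    module

end TypeD

/-! ### Type A. -/

section TypeA

/-- The usual `n + 1` coordinates do not fit orthogonally in `ℝⁿ`, so the normalization `e n = 0` is
used. Reflections then permute the `e k` only up to a common shift, which cancels in the differences
`e k - e l`. -/
theorem exists_frame_A (hα : IsSimpleRootSystem (CartanMatrix.A n) α) :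
    ∃ e : ℕ → EuclideanSpace ℝ (Fin n), (∀ k : Fin n, α k = e k - e (k + 1)) ∧
      ∀ i : Fin n, ∃ c : ℤ, ∀ k ≤ n,
        simpleReflection α i (e k) = e (Equiv.swap (i : ℕ) (i + 1) k) - c • α i := by
  obtain ⟨e, he0, he⟩ := exists_chain α 0 n
  have hsimple (k : Fin n) : α k = e k - e (k + 1) := by
    rw [he k k.2 k.2, add_sub_cancel_right]
  refine ⟨e, hsimple, fun i => ⟨if i.val + 1 = n then 1 else 0, fun k hk => ?_⟩⟩
  rw [simpleReflection_eq', inner_chain hα le_rfl he i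
    (fun k => (if k = i then 1 else 0) - (if k = i + 1 then 1 else 0) +
      if i.val + 1 = n then 1 else 0) ?_ ?_ k hk, Int.cast_smul_eq_zsmul, add_smul, ← sub_sub]
  · congr 1
    rw [hsimple i]
    rcases eq_or_ne k i with rfl | h1
    · simp
    · rcases eq_or_ne k (i + 1) with rfl | h2
      · simp
      · rw [Equiv.swap_apply_of_ne_of_ne h1 h2]
        simp [h1, h2]
  · rw [he0, inner_zero_left]
    norm_cast
    grind
  · intro k hk _
    simp only [CartanMatrix.A, Matrix.of_apply, Fin.ext_iff]
    grind

theorem ncard_evenGrid_A (hn : 1 ≤ n) (hα : IsSimpleRootSystem (CartanMatrix.A n) α) (j : Fin n)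
    {M : ℕ} (hM : 1 ≤ M) :
    (evenGrid α j M).ncard = (n + M).choose n + (M - 1).choose n := by
  obtain ⟨e, hsimple, hr⟩ := exists_frame_A hα
  have hr' (i : Fin n) {k l : ℕ} (hk : k ≤ n) (hl : l ≤ n) :
      simpleReflection α i (e k - e l) =
        e (Equiv.swap (i : ℕ) (i + 1) k) - e (Equiv.swap (i : ℕ) (i + 1) l) := by
    obtain ⟨c, hc⟩ := hr i
    rw [map_sub, hc k hk, hc l hl, sub_sub_sub_cancel_right]
  have hsub {k l : ℕ} (hkl : k ≤ l) (hl : l ≤ n) : e k - e l ∈ positiveCone α :=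
    sub_mem_positiveCone_of_le (fun k hk => ⟨⟨k, hk⟩, hsimple ⟨k, hk⟩⟩) hkl hl
  have hroots : roots α ⊆ {β | ∃ k ≤ n, ∃ l ≤ n, β = e k - e l} := by
    refine roots_subset (fun i => ⟨i, i.2.le, i + 1, i.2, hsimple i⟩) ?_
    rintro i _ ⟨k, hk, l, hl, rfl⟩
    have hswap {k : ℕ} (hk : k ≤ n) : Equiv.swap (i : ℕ) (i + 1) k ≤ n := by
      have := i.2
      rw [Equiv.swap_apply_def]
      split_ifs <;> omega
    exact ⟨_, hswap hk, _, hswap hl, hr' i hk hl⟩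
  have hmem : ∀ k, 1 ≤ k → k ≤ n → e 0 - e k ∈ roots α := by
    intro k hk
    induction k, hk using Nat.le_induction with
    | base =>
      intro _
      have := simple_mem_roots (α := α) ⟨0, by omega⟩
      rwa [hsimple] at this
    | succ k hk ih =>
      intro hkn
      -- `r_k` exchanges `e k` and `e (k + 1)` and leaves `e 0` in place because `1 ≤ k`.
      have := simpleReflection_mem_roots ⟨k, by omega⟩ (ih (by omega))
      have h0 : Equiv.swap k (k + 1) 0 = 0 :=
        Equiv.swap_apply_of_ne_of_ne (by omega) (by omega)
      rwa [hr' _ (by omega) (by omega), Equiv.swap_apply_left, h0] at this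
  have hξ : IsDominatingRoot α (e 0 - e n) := by
    refine ⟨hmem n hn le_rfl, fun β hβ => ?_, fun β hβ => ?_⟩
    · obtain ⟨k, hk, l, hl, rfl⟩ := hroots hβ
      rcases le_total k l with hkl | hkl
      · exact Or.inl (hsub hkl hl)
      · rw [neg_sub]
        exact Or.inr (hsub hkl hk)
    · obtain ⟨k, hk, l, hl, rfl⟩ := hroots hβ
      have := add_mem (hsub (Nat.zero_le k) hk) (hsub hl le_rfl)
      rwa [show e 0 - e k + (e l - e n) = e 0 - e n - (e k - e l) by abel] at this
  rw [hξ.ncard_evenGrid hα (m := fun _ => 1) (fun _ => le_rfl) ?_ j hM, ncard_setOf_pos_sum_lt,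
    ncard_setOf_sum_one_add_le hn]
  · have := ncard_setOf_sum_one_add_le hn 0 M
    simp only [add_zero, Nat.sub_zero] at this
    rw [this]
    congr 2
    simp only [Finset.sum_const, Finset.card_univ, Fintype.card_fin, smul_eq_mul, mul_one]
    omega
  · simp only [one_smul]
    rw [← Finset.sum_range_sub', ← Fin.sum_univ_eq_sum_range (fun i => e i - e (i + 1)) n]
    exact Finset.sum_congr rfl fun i _ => (hsimple i).symm

end TypeA

end EvenGrid

/-! ### Evaluation of the floors for even and odd `M`. -/

theorem mainTheorem3 :
    -- type `Aₙ`, `n ≥ 1`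
    (∀ (n : ℕ), 1 ≤ n → ∀ (α : Fin n → EuclideanSpace ℝ (Fin n)),
      EvenGrid.IsSimpleRootSystem (CartanMatrix.A n) α → ∀ (j : Fin n) (M : ℕ), 1 ≤ M →
        (EvenGrid.evenGrid α j M).ncard = (n + M).choose n + (M - 1).choose n) ∧
    -- type `Cₙ`, `n ≥ 2`, even and odd `M`
    (∀ (n : ℕ), 2 ≤ n → ∀ (α : Fin n → EuclideanSpace ℝ (Fin n)),
      EvenGrid.IsSimpleRootSystem (CartanMatrix.C n) α → ∀ (j : Fin n),
        (∀ k : ℕ, 1 ≤ k → (EvenGrid.evenGrid α j (2 * k)).ncard =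
          (n + k).choose n + (n + k - 1).choose n + k.choose n + (k - 1).choose n) ∧
        (∀ k : ℕ, (EvenGrid.evenGrid α j (2 * k + 1)).ncard =
          2 * (n + k).choose n + 2 * k.choose n)) ∧
    -- type `Bₙ`, `n ≥ 3`
    (∀ (n : ℕ), 3 ≤ n → ∀ (α β : Fin n → EuclideanSpace ℝ (Fin n)),
      EvenGrid.IsSimpleRootSystem (CartanMatrix.B n) α →
      EvenGrid.IsSimpleRootSystem (CartanMatrix.C n) β → ∀ (i j : Fin n) (M : ℕ), 1 ≤ M →
        (EvenGrid.evenGrid α i M).ncard = (EvenGrid.evenGrid β j M).ncard) ∧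
    -- type `Dₙ`, `n ≥ 4`, even and odd `M`
    (∀ (n : ℕ), 4 ≤ n → ∀ (α : Fin n → EuclideanSpace ℝ (Fin n)),
      EvenGrid.IsSimpleRootSystem (CartanMatrix.D n) α → ∀ (j : Fin n),
        (∀ k : ℕ, 1 ≤ k → (EvenGrid.evenGrid α j (2 * k)).ncard =
          (n + k).choose n + 6 * (n + k - 1).choose n + (n + k - 2).choose n +
            (k + 1).choose n + 6 * k.choose n + (k - 1).choose n) ∧
        (∀ k : ℕ, (EvenGrid.evenGrid α j (2 * k + 1)).ncard =
          4 * (n + k).choose n + 4 * (n + k - 1).choose n +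
            4 * (k + 1).choose n + 4 * k.choose n)) := by
  refine ⟨fun n hn α hα j M hM => EvenGrid.ncard_evenGrid_A hn hα j hM,
    fun n hn α hα j => ⟨fun k hk => ?_, fun k => ?_⟩, fun n hn α β hα hβ i j M hM => ?_,
    fun n hn α hα j => ⟨fun k hk => ?_, fun k => ?_⟩⟩
  · rw [EvenGrid.ncard_evenGrid_C hn hα j (by omega), ← add_assoc,
      show (2 * n + 2 * k) / 2 = n + k by omega, show (2 * n + 2 * k - 1) / 2 = n + k - 1 by omega,
      show 2 * k / 2 = k by omega, show (2 * k - 1) / 2 = k - 1 by omega]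
  · rw [EvenGrid.ncard_evenGrid_C hn hα j (by omega),
      show (2 * n + (2 * k + 1)) / 2 = n + k by omega,
      show (2 * n + (2 * k + 1) - 1) / 2 = n + k by omega,
      show (2 * k + 1) / 2 = k by omega, show (2 * k + 1 - 1) / 2 = k by omega]
    ring
  · rw [EvenGrid.ncard_evenGrid_B hn hα i hM, EvenGrid.ncard_evenGrid_C (by omega) hβ j hM]
  -- The weights `1, 3, 3, 1` come from the three parity splittings. For even `M` the two middle
  -- floors agree, giving `1, 6, 1`; for odd `M` the floors agree in consecutive pairs, giving `4,
  -- 4`.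
  · rw [EvenGrid.ncard_evenGrid_D hn hα j (by omega),
      show (2 * n + 2 * k) / 2 = n + k by omega, show (2 * n + 2 * k - 1) / 2 = n + k - 1 by omega,
      show (2 * n + 2 * k - 2) / 2 = n + k - 1 by omega,
      show (2 * n + 2 * k - 3) / 2 = n + k - 2 by omega,
      show (2 * k + 2) / 2 = k + 1 by omega, show (2 * k + 1) / 2 = k by omega,
      show 2 * k / 2 = k by omega, show (2 * k - 1) / 2 = k - 1 by omega]
    ring
  · rw [EvenGrid.ncard_evenGrid_D hn hα j (by omega),
      show (2 * n + (2 * k + 1)) / 2 = n + k by omega,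
      show (2 * n + (2 * k + 1) - 1) / 2 = n + k by omega,
      show (2 * n + (2 * k + 1) - 2) / 2 = n + k - 1 by omega,
      show (2 * n + (2 * k + 1) - 3) / 2 = n + k - 1 by omega,
      show (2 * k + 1 + 2) / 2 = k + 1 by omega, show (2 * k + 1 + 1) / 2 = k + 1 by omega,
      show (2 * k + 1) / 2 = k by omega, show (2 * k + 1 - 1) / 2 = k by omega]
    ring
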